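/- Let $K$ be an algebraically closed field of characteristic zero. For $(a_1,a_2,b_1,b_2)\in\mathbb A^4=K^4$ consider the monic quadratic polynomial endomorphism of $\mathbb P^2$ in the normal form \[ f=f_{a_1,a_2,b_1,b_2}:\ [x:y:z]\mapsto[x^2+a_1xz+a_2yz-a_1z^2:\ y^2+b_1xz+b_2yz-b_1z^2:\ z^2]. \] For a fixed point $P$ of $f$ let $\gamma_{f,P}(t)$ be the characteristic polynomial of the differential $df_P$ (the Jacobian matrix of $f$ at $P$ in affine coordinates), and let $m_P$ be the multiplicity of $P$, i.e. the $K$-dimension of the local ring at $P$ of the fixed point scheme of $f$. The multiplier invariants $\sigma_{i,j}=\sigma_{i,j}^{(1)}(f)$, $0\le i\le 7$, $0\le j\le 2i$, are defined by \[ \Sigma_1(f)=\prod_{P\in\mathrm{Fix}(f)}\bigl(w-\gamma_{f,P}(t)\bigr)^{m_P}=\sum_{i=0}^{7}\sum_{j=0}^{2i}(-1)^{i+j}\sigma_{i,j}\,w^{7-i}t^{2i-j}, \] and the fixed point multiplier map $\tau_{2,1}^2$ sends $f$ to the collection of all $\sigma_{i,j}$. Let $\phi:\mathbb A^4\to\mathbb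 A^5$ be the map \[ \phi(a_1,a_2,b_1,b_2)=(\sigma_{1,2},\sigma_{2,2},\sigma_{2,3},\sigma_{2,4},\sigma_{3,3}) \] and let $X\subset\mathbb A^5$ be the hypersurface $F(s_{12},s_{22},s_{23},s_{24},s_{33})=0$, where \[\begin{aligned} F={}&36s_{12}^5-18s_{12}^4s_{22}+2s_{12}^3s_{22}^2+17712s_{12}^4-8384s_{12}^3s_{22}+1292s_{12}^2s_{22}^2\\ &-64s_{12}s_{22}^3-2456s_{12}^3s_{23}+476s_{12}^2s_{22}s_{23}+73s_{12}^2s_{23}^2+16s_{12}s_{22}s_{23}^2\\ &+16s_{12}^3s_{24}+792s_{12}^3s_{33}-196s_{12}^2s_{22}s_{33}+8s_{12}s_{22}^2s_{33}-54s_{12}^2s_{23}s_{33}\\ &-4s_{12}s_{22}s_{23}s_{33}+9s_{12}^2s_{33}^2+197280s_{12}^3-105984s_{12}^2s_{22}+22464s_{12}s_{22}^2\\ &-1792s_{22}^3+48256s_{12}^2s_{23}-12064s_{12}s_{22}s_{23}-11336s_{12}s_{23}^2+1472s_{22}s_{23}^2+512s_{23}^3\\ &-51392s_{12}^2s_{24}+20480s_{12}s_{22}s_{24}-2048s_{22}^2s_{24}+10240s_{12}s_{23}s_{24}-2048s_{22}s_{23}s_{24}\\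 &-512s_{23}^2s_{24}+3008s_{12}^2s_{33}-2400s_{12}s_{22}s_{33}+480s_{22}^2s_{33}+2992s_{12}s_{23}s_{33}\\ &-240s_{22}s_{23}s_{33}-256s_{23}^2s_{33}-2560s_{12}s_{24}s_{33}+512s_{22}s_{24}s_{33}+256s_{23}s_{24}s_{33}\\ &-40s_{12}s_{33}^2-32s_{22}s_{33}^2+32s_{23}s_{33}^2-32s_{24}s_{33}^2+2411904s_{12}^2-1307136s_{12}s_{22}\\ &+171968s_{22}^2+268416s_{12}s_{23}+16064s_{22}s_{23}-38768s_{23}^2-613632s_{12}s_{24}+122880s_{22}s_{24}\\ &+61440s_{23}s_{24}+85376s_{12}s_{33}-32320s_{22}s_{33}+4768s_{23}s_{33}-15360s_{24}s_{33}+1232s_{33}^2\\ &+20517376s_{12}-5436928s_{22}-459776s_{23}-1844224s_{24}+532480s_{33}+56702976. \end{aligned}\] Then: 1. $X$ has dimension $4$, and $\phi$ is a dominant morphism of affine varieties $\mathbb A^4\to X$: it is given by polynomials, $\phi(\mathbb A^4)\subseteq X$, and the Zariski closure of $\phi(\mathbb A^4)$ is $X$. 2. $\phi$ is generically finite-to-one: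 there is a Zariski open dense subset $U\subseteq X$ such that for every $y\in U$ the fiber $\phi^{-1}(y)$ is zero-dimensional, that is, finite and nonempty. 3. The complete fixed point multiplier map $\tau_{2,1}^2$ is likewise generically finite-to-one on the normal form: if $Y$ is the Zariski closure of the image of $(a_1,a_2,b_1,b_2)\mapsto\tau_{2,1}^2(f)$, then there is a Zariski open dense subset $V\subseteq Y$ such that the fiber in $\mathbb A^4$ of this map over every point of $V$ is finite and nonempty. -/

import Mathlib

open MvPolynomial

noncomputable section

namespace FixedPointMultipliers

/-! ### Endomorphisms of projective space -/

/-- A degree `d` endomorphism of `ℙ^N` over an (algebraically closed) field `K`: an `(N+1)`-tuple of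
homogeneous polynomials of degree `d` without a common zero. -/
structure ProjEndo (K : Type*) [Field K] (N d : ℕ) where
  coord : Fin (N + 1) → MvPolynomial (Fin (N + 1)) K
  homog : ∀ i, (coord i).IsHomogeneous d
  no_common_zero : ∀ x : Fin (N + 1) → K, x ≠ 0 → ∃ i, eval x (coord i) ≠ 0

/-- Projective `N`-space over `K`. -/
abbrev PSpace (K : Type*) [Field K] (N : ℕ) : Type _ :=
  Projectivization K (Fin (N + 1) → K)

section general

variable {K : Type*} [Field K] {N d : ℕ}

/-- The self-map of `ℙ^N` given by `f`. (By homogeneity it does not depend on the representative.) -/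
def ProjEndo.map (f : ProjEndo K N d) (P : PSpace K N) : PSpace K N :=
  Projectivization.mk K (fun i => eval P.rep (f.coord i)) (by
    obtain ⟨i, hi⟩ := f.no_common_zero P.rep P.rep_nonzero
    exact fun h => hi (congrFun h i))

/-- The set of fixed points of `f`. -/
def ProjEndo.Fix (f : ProjEndo K N d) : Set (PSpace K N) :=
  {P | f.map P = P}

open Classical in
/-- The index `j` of the last nonzero homogeneous coordinate of `P`; the affine chart `x_j ≠ 0`
is the one in which the multiplier and the multiplicity at `P` are computed. -/
def chartIndex (P : PSpace K N) : Fin (N + 1) :=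
  (Finset.univ.filter fun i => P.rep i ≠ 0).max' (by
    obtain ⟨i, hi⟩ := Function.ne_iff.mp P.rep_nonzero
    exact ⟨i, by simpa using hi⟩)

/-- The representative of `P` whose coordinate with index `chartIndex P` is `1`. -/
def normRep (P : PSpace K N) : Fin (N + 1) → K :=
  (P.rep (chartIndex P))⁻¹ • P.rep

/-- The index type of the `N` affine coordinates `z_i = x_i / x_j` of the chart `x_j ≠ 0`. -/
abbrev ChartVar (j : Fin (N + 1)) : Type := {i : Fin (N + 1) // i ≠ j}

/-- The multiplier matrix of `f` at the fixed point `P`: the Jacobian matrix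
`(∂φ_v / ∂z_w)` at `P` of the dehomogenization `φ_v = f_v / f_j` of `f` in the chart `x_j = 1`,
written out by the quotient rule. -/
def ProjEndo.multiplierMatrix (f : ProjEndo K N d) (P : PSpace K N) :
    Matrix (ChartVar (chartIndex P)) (ChartVar (chartIndex P)) K :=
  Matrix.of fun v w =>
    (eval (normRep P) (pderiv w.1 (f.coord v.1)) * eval (normRep P) (f.coord (chartIndex P))
      - eval (normRep P) (pderiv w.1 (f.coord (chartIndex P))) * eval (normRep P) (f.coord v.1))
    / eval (normRep P) (f.coord (chartIndex P)) ^ 2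

/-- The multiplier polynomial `γ_{f,P}(t)`. -/
def ProjEndo.multiplierPoly (f : ProjEndo K N d) (P : PSpace K N) : Polynomial K :=
  (f.multiplierMatrix P).charpoly

/-- Dehomogenization: substitute `1` for `x_j`. -/
def dehomogenize (j : Fin (N + 1)) :
    MvPolynomial (Fin (N + 1)) K →ₐ[K] MvPolynomial (ChartVar j) K :=
  aeval fun i => if h : i = j then 1 else X ⟨i, h⟩

/-- The ideal of the fixed point scheme of `f` in the chart `x_j = 1`, generated by
`f_v - z_v f_j` for `v ≠ j`. -/
def ProjEndo.fixIdeal (f : ProjEndo K N d) (j : Fin (N + 1)) :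
    Ideal (MvPolynomial (ChartVar j) K) :=
  Ideal.span (Set.range fun v : ChartVar j =>
    dehomogenize j (f.coord v.1) - X v * dehomogenize j (f.coord j))

/-- The affine coordinates of `P` in its chart. -/
def affineCoords (P : PSpace K N) : ChartVar (chartIndex P) → K :=
  fun i => normRep P i.1

/-- The local ring of affine space `𝔸^ι` at the point `a`. -/
abbrev LocalRingAt {ι : Type*} (a : ι → K) : Type _ :=
  Localization.AtPrime (vanishingIdeal K ({a} : Set (ι → K)))

/-- The multiplicity of the fixed point `P` of `f`: the `K`-dimension of the local ring at `P` of the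
fixed point scheme of `f`. -/
def ProjEndo.multiplicity (f : ProjEndo K N d) (P : PSpace K N) : ℕ :=
  Module.finrank K (LocalRingAt (affineCoords P) ⧸
    (f.fixIdeal (chartIndex P)).map
      (algebraMap (MvPolynomial (ChartVar (chartIndex P)) K) (LocalRingAt (affineCoords P))))

/-- `Σ_1(f) = ∏_P (w - γ_{f,P}(t))`, the product over the fixed points of `f` with multiplicity.
The outer polynomial variable is `w`, the inner one is `t`. -/
def ProjEndo.Sigma1 (f : ProjEndo K N d) : Polynomial (Polynomial K) :=
  ∏ᶠ P ∈ f.Fix, (Polynomial.X - Polynomial.C (f.multiplierPoly P)) ^ f.multiplicity P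

/-- `D_1 = (d^(N+1) - 1) / (d - 1) = 1 + d + ⋯ + d^N`, the number of fixed points of a degree `d`
endomorphism of `ℙ^N`, counted with multiplicity. -/
def numFix (N d : ℕ) : ℕ := ∑ k ∈ Finset.range (N + 1), d ^ k

/-- The multiplier invariant `σ_{i,j}^{(1)}(f)`, for `i ≤ D_1` and `j ≤ N * i`, defined by
`Σ_1(f) = ∑_{i,j} (-1)^(i+j) σ_{i,j} w^(D_1-i) t^(N*i-j)`. -/
def ProjEndo.sigma (f : ProjEndo K N d) (i j : ℕ) : K :=
  (-1) ^ (i + j) * (f.Sigma1.coeff (numFix N d - i)).coeff (N * i - j)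

/-- The fixed point multiplier map `τ_{d,1}^N`: the complete collection of the `σ_{i,j}^{(1)}`,
`0 ≤ i ≤ D_1`, `0 ≤ j ≤ N * i`. -/
def ProjEndo.tau (f : ProjEndo K N d) :
    ((i : Fin (numFix N d + 1)) × Fin (N * (i : ℕ) + 1)) → K :=
  fun ij => f.sigma ij.1 ij.2

end general

/-! ### The normal form of monic quadratic polynomial endomorphisms of `ℙ²` -/

section normalForm

variable {K : Type*} [Field K]

/-- The coordinates of
`[x² + a₁xz + a₂yz - a₁z² : y² + b₁xz + b₂yz - b₁z² : z²]`, with `x = X 0`, `y = X 1`, `z = X 2`. -/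
def normalFormCoord (a₁ a₂ b₁ b₂ : K) : Fin (2 + 1) → MvPolynomial (Fin (2 + 1)) K :=
  ![X 0 ^ 2 + C a₁ * (X 0 * X 2) + C a₂ * (X 1 * X 2) - C a₁ * X 2 ^ 2,
    X 1 ^ 2 + C b₁ * (X 0 * X 2) + C b₂ * (X 1 * X 2) - C b₁ * X 2 ^ 2,
    X 2 ^ 2]

/-- The endomorphism of `ℙ²` in normal form with parameters `(a₁, a₂, b₁, b₂)`. -/
def normalForm (a₁ a₂ b₁ b₂ : K) : ProjEndo K 2 2 where
  coord := normalFormCoord a₁ a₂ b₁ b₂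
  homog := by
    have hs : ∀ i : Fin (2 + 1), (X i ^ 2 : MvPolynomial (Fin (2 + 1)) K).IsHomogeneous 2 :=
      fun i => isHomogeneous_X_pow i 2
    have hm : ∀ (c : K) (i j : Fin (2 + 1)),
        (C c * (X i * X j) : MvPolynomial (Fin (2 + 1)) K).IsHomogeneous 2 := fun c i j => by
      simpa using (isHomogeneous_C _ c).mul ((isHomogeneous_X K i).mul (isHomogeneous_X K j))
    have hc : ∀ (c : K) (i : Fin (2 + 1)),
        (C c * X i ^ 2 : MvPolynomial (Fin (2 + 1)) K).IsHomogeneous 2 := fun c i => by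
      simpa using (isHomogeneous_C _ c).mul (hs i)
    intro i
    fin_cases i
    · exact (((hs 0).add (hm a₁ 0 2)).add (hm a₂ 1 2)).sub (hc a₁ 2)
    · exact (((hs 1).add (hm b₁ 0 2)).add (hm b₂ 1 2)).sub (hc b₁ 2)
    · exact hs 2
  no_common_zero := by
    intro x hx
    by_contra! h
    have h2 : x 2 = 0 := by simpa [normalFormCoord] using h 2
    have h0 : x 0 = 0 := by simpa [normalFormCoord, h2] using h 0
    have h1 : x 1 = 0 := by simpa [normalFormCoord, h2] using h 1
    apply hx
    funext i
    fin_cases i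
    · exact h0
    · exact h1
    · exact h2

/-- The parameter space of the normal form is `𝔸⁴`, with coordinates `(a₁, a₂, b₁, b₂)`. -/
def normalFormOf (p : Fin 4 → K) : ProjEndo K 2 2 :=
  normalForm (p 0) (p 1) (p 2) (p 3)

variable (K) in
/-- The multiplier map
`φ : 𝔸⁴ → 𝔸⁵`, `(a₁, a₂, b₁, b₂) ↦ (σ_{1,2}, σ_{2,2}, σ_{2,3}, σ_{2,4}, σ_{3,3})`. -/
def phi (p : Fin 4 → K) : Fin 5 → K :=
  ![(normalFormOf p).sigma 1 2, (normalFormOf p).sigma 2 2, (normalFormOf p).sigma 2 3,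
    (normalFormOf p).sigma 2 4, (normalFormOf p).sigma 3 3]

variable (K) in
/-- The complete fixed point multiplier map `τ_{2,1}^2` on the normal form. -/
def tauNormalForm (p : Fin 4 → K) :
    ((i : Fin (numFix 2 2 + 1)) × Fin (2 * (i : ℕ) + 1)) → K :=
  (normalFormOf p).tau

end normalForm

/-! ### The hypersurface `X ⊂ 𝔸⁵` -/

/-- The equation of the hypersurface, in `σ_{1,2}, σ_{2,2}, σ_{2,3}, σ_{2,4}, σ_{3,3}`. -/
def hypersurfaceForm {R : Type*} [CommRing R] (s12 s22 s23 s24 s33 : R) : R :=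
  36 * s12^5 - 18 * s12^4 * s22 + 2 * s12^3 * s22^2 + 17712 * s12^4 - 8384 * s12^3 * s22
    + 1292 * s12^2 * s22^2 - 64 * s12 * s22^3 - 2456 * s12^3 * s23 + 476 * s12^2 * s22 * s23
    + 73 * s12^2 * s23^2 + 16 * s12 * s22 * s23^2 + 16 * s12^3 * s24 + 792 * s12^3 * s33
    - 196 * s12^2 * s22 * s33 + 8 * s12 * s22^2 * s33 - 54 * s12^2 * s23 * s33
    - 4 * s12 * s22 * s23 * s33 + 9 * s12^2 * s33^2 + 197280 * s12^3 - 105984 * s12^2 * s22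
    + 22464 * s12 * s22^2 - 1792 * s22^3 + 48256 * s12^2 * s23 - 12064 * s12 * s22 * s23
    - 11336 * s12 * s23^2 + 1472 * s22 * s23^2 + 512 * s23^3 - 51392 * s12^2 * s24
    + 20480 * s12 * s22 * s24 - 2048 * s22^2 * s24 + 10240 * s12 * s23 * s24
    - 2048 * s22 * s23 * s24 - 512 * s23^2 * s24 + 3008 * s12^2 * s33 - 2400 * s12 * s22 * s33
    + 480 * s22^2 * s33 + 2992 * s12 * s23 * s33 - 240 * s22 * s23 * s33 - 256 * s23^2 * s33
    - 2560 * s12 * s24 * s33 + 512 * s22 * s24 * s33 + 256 * s23 * s24 * s33 - 40 * s12 * s33^2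
    - 32 * s22 * s33^2 + 32 * s23 * s33^2 - 32 * s24 * s33^2 + 2411904 * s12^2
    - 1307136 * s12 * s22 + 171968 * s22^2 + 268416 * s12 * s23 + 16064 * s22 * s23
    - 38768 * s23^2 - 613632 * s12 * s24 + 122880 * s22 * s24 + 61440 * s23 * s24
    + 85376 * s12 * s33 - 32320 * s22 * s33 + 4768 * s23 * s33 - 15360 * s24 * s33 + 1232 * s33^2
    + 20517376 * s12 - 5436928 * s22 - 459776 * s23 - 1844224 * s24 + 532480 * s33 + 56702976

/-- The hypersurface `X ⊂ 𝔸⁵`. -/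
def hypersurfaceX (K : Type*) [Field K] : Set (Fin 5 → K) :=
  zeroLocus K (Ideal.span
    {hypersurfaceForm (X 0 : MvPolynomial (Fin 5) K) (X 1) (X 2) (X 3) (X 4)})

/-! ### Affine algebraic geometry over an algebraically closed field -/

section geometry

variable {K : Type*} [Field K] {ι κ : Type*}

/-- The Zariski closure of a subset of affine space. -/
def zariskiClosure (S : Set (κ → K)) : Set (κ → K) :=
  zeroLocus K (vanishingIdeal K S)

/-- The dimension of a Zariski closed subset of affine space: the Krull dimension of its coordinate
ring. -/
def zariskiDim (S : Set (κ → K)) : WithBot ℕ∞ :=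
  ringKrullDim (MvPolynomial κ K ⧸ vanishingIdeal K S)

/-- `U` is a Zariski open and Zariski dense subset of the Zariski closed set `S`. -/
def IsDenseOpenIn (U S : Set (κ → K)) : Prop :=
  (∃ J : Ideal (MvPolynomial κ K), U = S \ zeroLocus K J) ∧ zariskiClosure U = S

/-- `φ` is a dominant morphism from the affine space `𝔸^ι` to the closed set `S ⊆ 𝔸^κ`: it is given by
polynomials, maps into `S`, and has Zariski dense image in `S`. -/
def IsDominantMorphism (φ : (ι → K) → (κ → K)) (S : Set (κ → K)) : Prop :=
  (∃ p : κ → MvPolynomial ι K, ∀ x k, φ x k = eval x (p k)) ∧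
    (∀ x, φ x ∈ S) ∧ zariskiClosure (Set.range φ) = S

/-- The fibres of `φ` over the points of some dense open subset of `S` are nonempty and finite
(that is, zero-dimensional). -/
def IsGenericallyFinite (φ : (ι → K) → (κ → K)) (S : Set (κ → K)) : Prop :=
  ∃ U : Set (κ → K), IsDenseOpenIn U S ∧
    ∀ y ∈ U, (φ ⁻¹' {y}).Nonempty ∧ (φ ⁻¹' {y}).Finite

end geometry

end FixedPointMultipliers

end

open FixedPointMultipliers

namespace FixedPointMultipliers

noncomputable section

/-! ### Determinants of multiplication maps on finite algebras -/

/-! At an affine fixed point put `u = 2x + a₁` and `v = 2y + b₂`, the diagonal entries of the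
Jacobian matrix. With `α = a₂`, `β = b₁` and `z = w - t²`, the factor `w - γ(t)` is the value of `z
+ t(u + v) - (uv - αβ)`. The affine fixed points are the intersection of two conics in `u, v`, whose
coordinate ring has basis `1, u, v, uv`. The product of these values with multiplicity is the norm
of that element, hence a `4 × 4` determinant (`det_lmul_mk`, `det_lmul_conics`). The three points at
infinity are simple and contribute `z² (z + 2t)`.

The determinant is symmetric under `(α, A) ↔ (β, B)`, where `A`, `B` are the constants of the conics
after completing squares. So every multiplier invariant is a polynomial in `q = αβ`, `s = α + β`, `c
= A + B - 2s`, `r = αB + βA`, `n = AB` (`sigmaForm`, `sigma_normalFormOf`). The map `φ` amounts to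
`(q, c, r, n, qs)`, and `q ≠ 0` means `σ₁₂ ≠ 4`. The two numbers `αB + βA` and `αA + βB` have sum
and product expressible in the other invariants, so `r` satisfies a quadratic equation; multiplied
by `-4096 q²`, this equation is `F = 0`. Conversely, if it holds and `q ≠ 0`, one recovers `α, β, A,
B` up to finitely many choices, and then `a₁` as a root of a quartic and `b₂` rationally. Hence over
the part `σ₁₂ ≠ 4` of `X` the fibres of `φ` are finite and nonempty.

This part is dense because the prime `X 0 - 4` does not divide `F`. The dimension is at most 4 since
`F ≠ 0`, and at least 4 since `X 0 - 4` is a nonzerodivisor on `X` vanishing on a 3-dimensional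
affine subspace of `X`. For the complete map, every invariant times a power of `σ₁₂ - 4` is a
polynomial in the coordinates of `φ`. So where `σ₁₂ ≠ 4`, a point of `Y` is determined by its five
`φ`-coordinates and the fibres agree with those of `φ`. -/

theorem det_blockDiagonal' {o R : Type*} [Fintype o] [DecidableEq o] [CommRing R] {m : o → Type*}
    [∀ i, Fintype (m i)] [∀ i, DecidableEq (m i)] (M : ∀ i, Matrix (m i) (m i) R) :
    (Matrix.blockDiagonal' M).det = ∏ i, (M i).det := by
  classical
  -- Any linear order on the blocks makes the matrix block triangular.
  let _ : LinearOrder o := linearOrderOfSTO WellOrderingRel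
  rw [(Matrix.blockTriangular_blockDiagonal' M).det_fintype]
  refine Finset.prod_congr rfl fun i _ => ?_
  let e : m i ≃ {a : (i : o) × m i // a.1 = i} :=
    { toFun := fun x => ⟨⟨i, x⟩, rfl⟩
      invFun := fun a => a.2 ▸ a.1.2
      left_inv := fun x => rfl
      right_inv := by rintro ⟨⟨j, x⟩, rfl⟩; rfl }
  rw [← Matrix.det_submatrix_equiv_self e]
  congr 1
  ext x y
  simp [e, Matrix.toSquareBlock_def, Matrix.blockDiagonal'_apply_eq]

theorem det_pi_map {K ι : Type*} [Field K] [Fintype ι] (M : ι → Type*)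
    [∀ i, AddCommGroup (M i)] [∀ i, Module K (M i)] [∀ i, Module.Finite K (M i)]
    (f : ∀ i, M i →ₗ[K] M i) :
    LinearMap.det (LinearMap.pi fun i => (f i).comp (LinearMap.proj i))
      = ∏ i, LinearMap.det (f i) := by
  classical
  let b := fun i => Module.Free.chooseBasis K (M i)
  rw [← LinearMap.det_toMatrix (Pi.basis b)]
  simp_rw [fun i => (LinearMap.det_toMatrix (b i) (f i)).symm]
  rw [← det_blockDiagonal']
  congr 1
  ext ⟨i, x⟩ ⟨j, y⟩
  by_cases h : i = j
  · subst h
    simp [LinearMap.toMatrix_apply, Pi.basis_apply]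
  · simp [LinearMap.toMatrix_apply, Matrix.blockDiagonal'_apply_ne _ _ _ h, Pi.basis_apply, h]

/-- Multiplication by the nilpotent `x - a` has characteristic polynomial `X ^ n`; its value at `x`
is the determinant of `x - (x - a) = a`. -/
theorem det_mulLeft_of_isNilpotent_sub {K A : Type*} [Field K] [CommRing A] [Algebra K A]
    [Module.Finite K A] {a : A} {x : K} (h : IsNilpotent (algebraMap K A x - a)) :
    LinearMap.det (Algebra.lmul K A a) = x ^ Module.finrank K A := by
  have h1 : IsNilpotent (Algebra.lmul K A (algebraMap K A x - a)) := h.map _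
  have h2 := congrArg (Polynomial.eval x) h1.charpoly_eq_X_pow_finrank
  rw [LinearMap.eval_charpoly, Polynomial.eval_pow, Polynomial.eval_X] at h2
  rw [← h2]
  congr 1
  ext b
  simp [Algebra.algebraMap_eq_smul_one]

theorem isNilpotent_of_mem_maximalIdeal (K : Type*) {A : Type*} [Field K] [CommRing A]
    [IsLocalRing A] [Algebra K A] [Module.Finite K A] {a : A}
    (h : a ∈ IsLocalRing.maximalIdeal A) : IsNilpotent a := by
  have : IsArtinianRing A := IsArtinianRing.of_finite K A
  rw [← IsLocalRing.jacobson_eq_maximalIdeal ⊥ bot_ne_top] at h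
  obtain ⟨n, hn⟩ := IsArtinianRing.isNilpotent_jacobson_bot (R := A)
  refine ⟨n, ?_⟩
  have h1 := Ideal.pow_mem_pow h n
  rw [hn] at h1
  simpa using h1

/-- The norm of an element of a finite product of finite local algebras with residue field `K`. -/
theorem det_lmul_of_algEquiv_pi {K A ι : Type*} [Field K] [CommRing A] [Algebra K A]
    [Module.Finite K A] [Fintype ι] {B : ι → Type*} [∀ i, CommRing (B i)]
    [∀ i, Algebra K (B i)] [∀ i, IsLocalRing (B i)] (e : A ≃ₐ[K] ∀ i, B i) (a : A) (x : ι → K)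
    (hx : ∀ i, algebraMap K (B i) (x i) - e a i ∈ IsLocalRing.maximalIdeal (B i)) :
    LinearMap.det (Algebra.lmul K A a) = ∏ i, x i ^ Module.finrank K (B i) := by
  have hfin (i : ι) : Module.Finite K (B i) :=
    Module.Finite.of_surjective ((LinearMap.proj i).comp e.toLinearEquiv.toLinearMap)
      ((Function.surjective_eval i).comp e.surjective)
  have h1 : LinearMap.det (Algebra.lmul K A a) =
      ∏ i, LinearMap.det (Algebra.lmul K (B i) (e a i)) := by
    rw [← det_pi_map, ← LinearMap.det_conj _ e.toLinearEquiv]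
    congr 1
    refine LinearMap.ext fun y => ?_
    obtain ⟨y, rfl⟩ := e.surjective y
    funext i
    simp
  rw [h1]
  exact Finset.prod_congr rfl fun i _ =>
    det_mulLeft_of_isNilpotent_sub (isNilpotent_of_mem_maximalIdeal K (hx i))

/-! ### Norms on finite coordinate rings as products over zeros -/

section norm

variable {K ι : Type*} [Field K] (I : Ideal (MvPolynomial ι K))

/-- Evaluation at a zero of `I`, as a homomorphism on the coordinate ring. -/
def evalQuotient (a : zeroLocus K I) : (MvPolynomial ι K ⧸ I) →+* K :=
  Ideal.Quotient.lift I (eval (a : ι → K)) fun p hp => by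
    simpa [aeval_eq_eval] using a.2 p hp

@[simp]
theorem evalQuotient_mk (a : zeroLocus K I) (p : MvPolynomial ι K) :
    evalQuotient I a (Ideal.Quotient.mk I p) = eval (a : ι → K) p := rfl

theorem evalQuotient_surjective (a : zeroLocus K I) :
    Function.Surjective (evalQuotient I a) := fun x =>
  ⟨Ideal.Quotient.mk I (C x), by simp⟩

/-- The maximal ideal of the coordinate ring at a zero of `I`. -/
def maximalAt (a : zeroLocus K I) : MaximalSpectrum (MvPolynomial ι K ⧸ I) :=
  ⟨RingHom.ker (evalQuotient I a),
    RingHom.ker_isMaximal_of_surjective _ (evalQuotient_surjective I a)⟩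

theorem comap_maximalAt (a : zeroLocus K I) :
    (maximalAt I a).asIdeal.comap (Ideal.Quotient.mk I)
      = vanishingIdeal K ({(a : ι → K)} : Set (ι → K)) := by
  ext p
  rw [mem_vanishingIdeal_singleton_iff]
  simp [maximalAt, RingHom.mem_ker, aeval_eq_eval]

/-- Nullstellensatz: maximal ideals of the quotient are the maximal ideals of points at which `I`
vanishes. -/
theorem maximalAt_bijective [IsAlgClosed K] [Finite ι] : Function.Bijective (maximalAt I) := by
  refine ⟨fun a b h => ?_, fun M => ?_⟩
  · have h1 := comap_maximalAt I a
    rw [h, comap_maximalAt] at h1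
    ext i
    have h2 : (X i - C ((b : ι → K) i)) ∈ vanishingIdeal K ({(b : ι → K)} : Set (ι → K)) := by
      rw [mem_vanishingIdeal_singleton_iff]
      simp
    rw [h1, mem_vanishingIdeal_singleton_iff] at h2
    simpa [sub_eq_zero] using h2
  · have hM := M.isMaximal
    have h1 : (M.asIdeal.comap (Ideal.Quotient.mk I)).IsMaximal :=
      Ideal.comap_isMaximal_of_surjective _ Ideal.Quotient.mk_surjective
    obtain ⟨x, hx⟩ := isMaximal_iff_eq_vanishingIdeal_singleton.mp h1
    have h2 : x ∈ zeroLocus K I := fun p hp => by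
      rw [← mem_vanishingIdeal_singleton_iff, ← hx, Ideal.mem_comap,
        Ideal.Quotient.eq_zero_iff_mem.mpr hp]
      exact zero_mem _
    refine ⟨⟨x, h2⟩, MaximalSpectrum.ext ?_⟩
    apply Ideal.comap_injective_of_surjective (Ideal.Quotient.mk I) Ideal.Quotient.mk_surjective
    rw [comap_maximalAt, hx]

/-- Localization commutes with passing to the quotient by `I`. This identifies the local factors of
the coordinate ring with the local rings that define `multiplicity`. -/
theorem finrank_localization_maximalAt (a : zeroLocus K I) :
    Module.finrank K (Localization.AtPrime (maximalAt I a).asIdeal)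
      = Module.finrank K (LocalRingAt (a : ι → K) ⧸
          I.map (algebraMap (MvPolynomial ι K) (LocalRingAt (a : ι → K)))) := by
  have h : Algebra.algebraMapSubmonoid (MvPolynomial ι K ⧸ I)
      (vanishingIdeal K ({(a : ι → K)} : Set (ι → K))).primeCompl
      = (maximalAt I a).asIdeal.primeCompl := by
    ext x
    obtain ⟨p, rfl⟩ := Ideal.Quotient.mk_surjective x
    have key (q : MvPolynomial ι K) : q ∈ vanishingIdeal K ({(a : ι → K)} : Set (ι → K)) ↔
        Ideal.Quotient.mk I q ∈ (maximalAt I a).asIdeal := by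
      rw [← comap_maximalAt, Ideal.mem_comap]
    constructor
    · rintro ⟨q, hq, hqp⟩
      rw [← hqp]
      exact fun hm => hq ((key q).mpr hm)
    · exact fun hp => ⟨p, fun hm => hp ((key p).mp hm), rfl⟩
  have h1 : IsLocalization.AtPrime (LocalRingAt (a : ι → K) ⧸
      I.map (algebraMap (MvPolynomial ι K) (LocalRingAt (a : ι → K))))
      (maximalAt I a).asIdeal := by
    rw [IsLocalization.AtPrime, ← h]
    infer_instance
  have e := IsLocalization.algEquiv (maximalAt I a).asIdeal.primeCompl
    (Localization.AtPrime (maximalAt I a).asIdeal) (LocalRingAt (a : ι → K) ⧸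
      I.map (algebraMap (MvPolynomial ι K) (LocalRingAt (a : ι → K))))
  have : IsScalarTower K (MvPolynomial ι K ⧸ I) (LocalRingAt (a : ι → K) ⧸
      I.map (algebraMap (MvPolynomial ι K) (LocalRingAt (a : ι → K)))) :=
    ⟨fun k x s => by
      obtain ⟨p, rfl⟩ := Ideal.Quotient.mk_surjective x
      obtain ⟨y, rfl⟩ := Ideal.Quotient.mk_surjective s
      exact congrArg (Ideal.Quotient.mk _) (smul_assoc k p y)⟩
  exact (e.restrictScalars K).toLinearEquiv.finrank_eq

theorem finite_zeroLocus [IsAlgClosed K] [Finite ι] [Module.Finite K (MvPolynomial ι K ⧸ I)] :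
    (zeroLocus K I).Finite := by
  have := IsArtinianRing.of_finite K (MvPolynomial ι K ⧸ I)
  exact Set.finite_coe_iff.mp (Finite.of_injective _ (maximalAt_bijective I).1)

/-- The norm of the class of `g` in a finite coordinate ring is the product of the values of `g`
at the zeros, with multiplicity. -/
theorem det_lmul_mk [IsAlgClosed K] [Finite ι] [Module.Finite K (MvPolynomial ι K ⧸ I)]
    (g : MvPolynomial ι K) :
    LinearMap.det (Algebra.lmul K (MvPolynomial ι K ⧸ I) (Ideal.Quotient.mk I g))
      = ∏ᶠ a ∈ zeroLocus K I, eval a g ^ Module.finrank K (LocalRingAt a ⧸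
          I.map (algebraMap (MvPolynomial ι K) (LocalRingAt a))) := by
  have := IsArtinianRing.of_finite K (MvPolynomial ι K ⧸ I)
  have := Fintype.ofFinite (MaximalSpectrum (MvPolynomial ι K ⧸ I))
  let e := Equiv.ofBijective _ (maximalAt_bijective I)
  have he (m : MaximalSpectrum (MvPolynomial ι K ⧸ I)) : maximalAt I (e.symm m) = m :=
    e.apply_symm_apply m
  -- The Artinian coordinate ring is the product of its localizations at its maximal ideals, and in
  -- each factor `g` differs from its value at the point by an element of the maximal ideal.
  rw [det_lmul_of_algEquiv_pi
    (B := fun m : MaximalSpectrum (MvPolynomial ι K ⧸ I) => Localization.AtPrime m.asIdeal)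
    ((MaximalSpectrum.toPiLocalizationEquiv (MvPolynomial ι K ⧸ I)).restrictScalars K) _
    (fun m => eval (e.symm m : ι → K) g) fun m => ?_,
    ← finprod_set_coe_eq_finprod_mem (s := zeroLocus K I) (f := fun a => eval a g ^
      Module.finrank K (LocalRingAt a ⧸
        I.map (algebraMap (MvPolynomial ι K) (LocalRingAt a)))),
    ← finprod_eq_prod_of_fintype]
  · symm
    refine finprod_eq_of_bijective (maximalAt I) (maximalAt_bijective I) fun a => ?_
    have h1 : e.symm (maximalAt I a) = a := e.symm_apply_apply a
    rw [← finrank_localization_maximalAt, h1]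
  · have key (a : zeroLocus K I) : algebraMap K _ (eval (a : ι → K) g) - Ideal.Quotient.mk I g
        ∈ (maximalAt I a).asIdeal := by
      simp only [maximalAt, RingHom.mem_ker]
      rw [map_sub, evalQuotient_mk, sub_eq_zero]
      exact (evalQuotient_mk I a (C _)).trans (by simp)
    have h2 := key (e.symm m)
    rw [he] at h2
    have h3 := (IsLocalization.AtPrime.to_map_mem_maximal_iff
      (Localization.AtPrime m.asIdeal) m.asIdeal _).mpr h2
    rw [map_sub, ← IsScalarTower.algebraMap_apply] at h3
    exact h3

end norm

/-! ### Two conics without common points at infinity -/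

open scoped IsMulCommutative in
-- The target is noncommutative (a matrix algebra in the application), but commuting elements
-- generate a commutative subalgebra, to which the universal property applies.
theorem exists_algHom_of_commute {K ι A : Type*} [Field K] [Ring A] [Algebra K A] (x : ι → A)
    (h : ∀ i j, x i * x j = x j * x i) :
    ∃ θ : MvPolynomial ι K →ₐ[K] A, ∀ i, θ (X i) = x i := by
  have hc : ∀ a ∈ Set.range x, ∀ b ∈ Set.range x, a * b = b * a := by
    rintro _ ⟨i, rfl⟩ _ ⟨j, rfl⟩
    exact h i j
  have := Algebra.isMulCommutative_adjoin K hc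
  let θ : MvPolynomial ι K →ₐ[K] Algebra.adjoin K (Set.range x) :=
    aeval fun i => ⟨x i, Algebra.subset_adjoin ⟨i, rfl⟩⟩
  refine ⟨(Algebra.adjoin K (Set.range x)).val.comp θ, fun i => ?_⟩
  simp [θ]

/-- Multiplication by `u` on `K[u, v] / (u² - 2u + 2αv - A, v² - 2v + 2βu - B)` in the basis
`1, u, v, uv`. -/
def mulU {R : Type*} [CommRing R] (α β A B : R) : Matrix (Fin 4) (Fin 4) R :=
  !![0, A, 0, -2 * α * B; 1, 2, 0, 4 * α * β; 0, -2 * α, 0, A - 4 * α; 0, 0, 1, 2]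

/-- Multiplication by `v` on `K[u, v] / (u² - 2u + 2αv - A, v² - 2v + 2βu - B)` in the basis
`1, u, v, uv`. -/
def mulV {R : Type*} [CommRing R] (α β A B : R) : Matrix (Fin 4) (Fin 4) R :=
  !![0, 0, B, -2 * β * A; 0, 0, -2 * β, B - 4 * β; 1, 0, 2, 4 * α * β; 0, 1, 0, 2]

section matrices

variable {R : Type*} [CommRing R] (α β A B : R)

/-- Together with `mulU_sq` and `mulV_sq`, this makes the two matrices a representation of the
coordinate ring of the conics, from which the independence of `1, u, v, uv` follows. -/
theorem mulU_mul_mulV_comm : mulU α β A B * mulV α β A B = mulV α β A B * mulU α β A B := by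
  ext i j
  fin_cases i <;> fin_cases j <;>
    simp [mulU, mulV, Matrix.mul_apply, Fin.sum_univ_four] <;> ring

theorem mulU_sq : mulU α β A B * mulU α β A B =
    (2 : R) • mulU α β A B - (2 * α) • mulV α β A B + A • 1 := by
  ext i j
  fin_cases i <;> fin_cases j <;>
    simp [mulU, mulV, Matrix.mul_apply, Fin.sum_univ_four] <;> ring

theorem mulV_sq : mulV α β A B * mulV α β A B =
    (2 : R) • mulV α β A B - (2 * β) • mulU α β A B + B • 1 := by
  ext i j
  fin_cases i <;> fin_cases j <;>
    simp [mulU, mulV, Matrix.mul_apply, Fin.sum_univ_four] <;> ring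

/-- The quartic `det (z + t (u + v) - (u v - α β))` in terms of `q = α β`, `s = α + β`,
`c = A' + B' - 2 s`, `r = α B' + β A'` and `n = A' B'`, where `A' = A + 1` and `B' = B + 1`. -/
def quarticForm (q s c r n t z : R) : R :=
  z ^ 4 + ((- 8*q - 4) + (8) * t) * z ^ 3
  + ((18*q^2 - 2*c - 2*n - 28*q + 12*r + 6) + (4*c + 8*q - 8*r - 24) * t + (- 2*c - 12*q + 24) *
    t^2) * z ^ 2
  + ((- 40*c*q + 8*c*r - 8*n*s - 24*q*r - 24*q*s + 84*q^2 + 16*r*s + 4*c - 4*n + 16*q - 4) +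
    (48*c*q - 8*c*r + 8*n*s + 24*q*r + 8*q*s - 72*q^2 - 16*r*s - 16*c + 8*n - 64*q + 8*r + 24) *
    t + (- 8*c*q + 24*q*s + 24*q^2 + 20*c - 8*n + 24*q + 8*r - 48) * t^2 + (- 8*q*s - 8*c - 16*q
    - 8*r + 32) * t^3) * z
  + ((- 27*q^4 + 4*c*n*q + 24*c*q*r - 54*c*q^2 - 4*c*r^2 - 16*n*q*s + 18*n*q^2 + 4*n*r*s +
    48*q*r*s - 36*q^2*r - 56*q^2*s + 108*q^3 - 8*r^2*s - 2*c*n + 4*c*r + c^2 - 12*n*q - 4*n*r +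
    n^2 - 32*q*r + 8*q*s + 26*q^2 - 4*r*s + 12*r^2 - 2*c + 2*n + 4*q - 4*r + 1) + (12*c*q^2 -
    24*q^2*s - 72*q^3 + 4*c*n - 16*c*q - 8*c*r - 4*c^2 + 40*n*q + 24*q*r - 24*q*s + 24*q^2 +
    16*r*s - 16*r^2 + 12*c - 8*n - 8*q + 16*r - 8) * t + (- 6*c*q^2 + 24*q^2*s + 36*q^3 - 2*c*n
    + 12*c*r + 6*c^2 - 20*n*q - 8*n*s - 24*q*r - 8*q*s - 8*r*s + 8*r^2 - 26*c + 8*n + 4*q - 24*r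
    + 24) * t^2 + (- 8*q^2*s + 16*c*q - 8*c*r - 4*c^2 + 8*n*s + 16*q*r + 24*q*s - 16*q^2 + 24*c
    - 16*q + 24*r - 32) * t^3 + (c^2 - 4*r*s - 8*c - 4*n - 8*r + 16) * t^4)

/-- Exchanging `(α, A)` with `(β, B)` exchanges `mulU` and `mulV` up to a permutation of the basis,
so the determinant is symmetric and can be written in the five invariants. -/
theorem det_eq_quarticForm (t z : R) :
    (z • 1 + t • (mulU α β A B + mulV α β A B) - mulU α β A B * mulV α β A B
      + (α * β) • (1 : Matrix (Fin 4) (Fin 4) R)).det =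
    quarticForm (α * β) (α + β) ((A + 1) + (B + 1) - 2 * (α + β)) (α * (B + 1) + β * (A + 1))
      ((A + 1) * (B + 1)) t z := by
  have h : z • 1 + t • (mulU α β A B + mulV α β A B) - mulU α β A B * mulV α β A B
      + (α * β) • (1 : Matrix (Fin 4) (Fin 4) R) =
      !![α*β + z, A*t + 2*B*α, 2*A*β + B*t, - 2*A*β*t - 2*B*α*t - A*B + 4*A*β + 4*B*α;
      t, - 3*α*β + 2*t + z, - 2*β*t - B + 4*β, 4*α*β*t + 2*A*β + B*t - 8*α*β - 4*β*t - 2*B + 8*β;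
      t, - 2*α*t - A + 4*α, - 3*α*β + 2*t + z, 4*α*β*t + A*t + 2*B*α - 8*α*β - 4*α*t - 2*A + 8*α;
      - 1, t - 2, t - 2, - 3*α*β + 4*t + z - 4] := by
    ext i j
    fin_cases i <;> fin_cases j <;>
      simp [mulU, mulV] <;> ring
  rw [h]
  simp [Matrix.det_succ_row_zero, Fin.sum_univ_succ, Fin.succAbove, quarticForm]
  ring

end matrices

section conics

open scoped Matrix

variable {K ι : Type*} [Field K] [CharZero K] {i₀ i₁ : ι}

/-- The coordinate ring of two conics `u² - 2u + 2αv = A`, `v² - 2v + 2βu = B` has dimension four,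
and the norm of `z + t (u + v) - (u v - α β)` is given by `quarticForm`. -/
theorem det_lmul_conics (hι : ∀ i, i = i₀ ∨ i = i₁) (h01 : i₀ ≠ i₁) (a b α β A B : K)
    (u v : MvPolynomial ι K) (hu : u = 2 * X i₀ + C a) (hv : v = 2 * X i₁ + C b)
    (I : Ideal (MvPolynomial ι K))
    (hI : I = Ideal.span {u ^ 2 - 2 * u + 2 * C α * v - C A, v ^ 2 - 2 * v + 2 * C β * u - C B}) :
    Module.Finite K (MvPolynomial ι K ⧸ I) ∧ ∀ t z : K,
      LinearMap.det (Algebra.lmul K (MvPolynomial ι K ⧸ I)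
        (Ideal.Quotient.mk I (C z + C t * (u + v) - u * v + C (α * β)))) =
      quarticForm (α * β) (α + β) ((A + 1) + (B + 1) - 2 * (α + β)) (α * (B + 1) + β * (A + 1))
        ((A + 1) * (B + 1)) t z := by
  classical
  set U := mulU α β A B with hU
  set V := mulV α β A B with hV
  have hUV : U * V = V * U := mulU_mul_mulV_comm α β A B
  have hUU : U * U = (2 : K) • U - (2 * α) • V + A • 1 := mulU_sq α β A B
  have hVV : V * V = (2 : K) • V - (2 * β) • U + B • 1 := mulV_sq α β A B
  have h2 : (2 : K) ≠ 0 := two_ne_zero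
  -- The images of the variables are forced by `u ↦ U` and `v ↦ V`, since `u = 2 X i₀ + a` and `v =
  -- 2 X i₁ + b`.
  obtain ⟨θ, hθ⟩ := exists_algHom_of_commute (K := K)
    (fun i : ι => if i = i₀ then (2 : K)⁻¹ • (U - a • 1) else (2 : K)⁻¹ • (V - b • 1))
    (by
      intro i j
      by_cases hi : i = i₀ <;> by_cases hj : j = i₀ <;>
        simp [hi, hj, sub_mul, mul_sub, hUV] <;> module)
  have hθC (k : K) : θ (C k) = k • 1 := by
    rw [← algebraMap_eq, AlgHom.commutes, Algebra.algebraMap_eq_smul_one]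
  have hθ2 : θ 2 = (2 : K) • 1 := by
    rw [← hθC]
    exact congrArg θ (map_ofNat C 2).symm
  have hθu : θ u = U := by
    rw [hu, map_add, map_mul, hθ, hθC, hθ2]
    simp [smul_smul, h2]
  have hθv : θ v = V := by
    rw [hv, map_add, map_mul, hθ, hθC, hθ2]
    simp [smul_smul, h2, h01.symm]
  have hθI : ∀ p ∈ I, θ p = 0 := by
    have : I ≤ RingHom.ker θ := by
      rw [hI, Ideal.span_le]
      rintro p (rfl | rfl)
      · simp [hθu, hθv, hθC, hθ2, pow_two, hUU, smul_smul]
        module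
      · simp [hθu, hθv, hθC, hθ2, pow_two, hVV, smul_smul]
        module
    exact fun p hp => this hp
  let θ' : (MvPolynomial ι K ⧸ I) →ₐ[K] Matrix (Fin 4) (Fin 4) K := Ideal.Quotient.liftₐ I θ hθI
  have hθ' (p) : θ' (Ideal.Quotient.mk I p) = θ p := rfl
  -- The first basis vector stands for `1`, so applying the matrix of `p` to it reads off the
  -- coordinates of `p`. The map `rep` below inverts this modulo `I`.
  let E : (MvPolynomial ι K ⧸ I) →ₗ[K] (Fin 4 → K) :=
    { toFun := fun p => (θ' p) *ᵥ Pi.single 0 1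
      map_add' := fun p q => by rw [map_add, Matrix.add_mulVec]
      map_smul' := fun k p => by rw [map_smul, Matrix.smul_mulVec, RingHom.id_apply] }
  have hEmul (p q) : E (p * q) = θ' p *ᵥ E q := by
    change θ' (p * q) *ᵥ Pi.single 0 1 = θ' p *ᵥ (θ' q *ᵥ Pi.single 0 1)
    rw [map_mul, Matrix.mulVec_mulVec]
  have hE (p) : E (Ideal.Quotient.mk I p) = θ p *ᵥ Pi.single 0 1 := rfl
  obtain ⟨rep, hrepdef⟩ : ∃ rep : (Fin 4 → K) → MvPolynomial ι K, ∀ c, rep c =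
    C (c 0) + C (c 1) * u + C (c 2) * v + C (c 3) * (u * v) := ⟨_, fun _ => rfl⟩
  have hC2 : (C 2 : MvPolynomial ι K) = 2 := map_ofNat C 2
  have hC4 : (C 4 : MvPolynomial ι K) = 4 := map_ofNat C 4
  have hrep (c) : E (Ideal.Quotient.mk I (rep c)) = c := by
    rw [hE]
    simp only [hrepdef, map_add, map_mul, hθu, hθv, hθC]
    ext i
    fin_cases i <;> simp [hU, hV, mulU, mulV]
  have hP : u ^ 2 - 2 * u + 2 * C α * v - C A ∈ I := hI ▸ Ideal.subset_span (by simp)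
  have hQ : v ^ 2 - 2 * v + 2 * C β * u - C B ∈ I := hI ▸ Ideal.subset_span (by simp)
  -- The products outside the basis are `u²` and `u²v`. Reducing the latter by the first conic
  -- leaves `-2αv²`, hence the multiple of the second conic.
  have hmulU (c) : u * rep c - rep (U *ᵥ c) ∈ I := by
    have : u * rep c - rep (U *ᵥ c) = (C (c 1) + C (c 3) * v) * (u ^ 2 - 2 * u + 2 * C α * v - C A)
        + C (c 3) * (-2 * C α) * (v ^ 2 - 2 * v + 2 * C β * u - C B) := by
      simp [hrepdef, hC2, hC4, hU, mulU, dotProduct, Fin.sum_univ_four]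
      ring
    rw [this]
    exact I.add_mem (I.mul_mem_left _ hP) (I.mul_mem_left _ hQ)
  have hmulV (c) : v * rep c - rep (V *ᵥ c) ∈ I := by
    have : v * rep c - rep (V *ᵥ c) = (C (c 2) + C (c 3) * u) * (v ^ 2 - 2 * v + 2 * C β * u - C B)
        + C (c 3) * (-2 * C β) * (u ^ 2 - 2 * u + 2 * C α * v - C A) := by
      simp [hrepdef, hC2, hC4, hV, mulV, dotProduct, Fin.sum_univ_four]
      ring
    rw [this]
    exact I.add_mem (I.mul_mem_left _ hQ) (I.mul_mem_left _ hP)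
  -- The span of `1, u, v, uv` modulo `I` contains the constants and is stable under multiplication
  -- by the variables.
  have hspan (p : MvPolynomial ι K) :
      Ideal.Quotient.mk I p = Ideal.Quotient.mk I (rep (E (Ideal.Quotient.mk I p))) := by
    have hrepadd (c d) : rep (c + d) = rep c + rep d := by simp [hrepdef]; ring
    have hrepsmul (k : K) (c) : rep (k • c) = C k * rep c := by simp [hrepdef]; ring
    have hmU (c) : Ideal.Quotient.mk I (rep (U *ᵥ c)) = Ideal.Quotient.mk I (u * rep c) :=
      (Ideal.Quotient.eq.mpr (hmulU c)).symm
    have hmV (c) : Ideal.Quotient.mk I (rep (V *ᵥ c)) = Ideal.Quotient.mk I (v * rep c) :=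
      (Ideal.Quotient.eq.mpr (hmulV c)).symm
    induction p using MvPolynomial.induction_on with
    | C k =>
      rw [hE, hθC]
      congr 1
      simp [hrepdef]
    | add p q hp hq => rw [map_add, map_add, hrepadd, map_add, ← hp, ← hq]
    | mul_X p i hp =>
      have hi : E (Ideal.Quotient.mk I (p * X i)) = θ (X i) *ᵥ E (Ideal.Quotient.mk I p) := by
        rw [mul_comm, map_mul, hEmul, hθ']
      set c := E (Ideal.Quotient.mk I p)
      rw [hi, hθ, map_mul, hp, ← map_mul]
      have hhalf : (C (2 : K)⁻¹ : MvPolynomial ι K) * 2 = 1 := by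
        rw [← map_ofNat C 2, ← C_mul, inv_mul_cancel₀ h2, C_1]
      rcases hι i with rfl | rfl
      · rw [if_pos rfl, Matrix.smul_mulVec, Matrix.sub_mulVec, Matrix.smul_mulVec,
          Matrix.one_mulVec, sub_eq_add_neg, ← neg_smul, hrepsmul, hrepadd, hrepsmul,
          map_mul (Ideal.Quotient.mk I) (C _), map_add (Ideal.Quotient.mk I), hmU, ← map_add,
          ← map_mul]
        congr 1
        rw [hu, C_neg]
        linear_combination (-(X i * rep c)) * hhalf
      · rw [if_neg h01.symm, Matrix.smul_mulVec, Matrix.sub_mulVec, Matrix.smul_mulVec,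
          Matrix.one_mulVec, sub_eq_add_neg, ← neg_smul, hrepsmul, hrepadd, hrepsmul,
          map_mul (Ideal.Quotient.mk I) (C _), map_add (Ideal.Quotient.mk I), hmV, ← map_add,
          ← map_mul]
        congr 1
        rw [hv, C_neg]
        linear_combination (-(X i * rep c)) * hhalf
  have hbij : Function.Bijective E := by
    refine ⟨fun x y hxy => ?_, fun c => ⟨_, hrep c⟩⟩
    obtain ⟨p, rfl⟩ := Ideal.Quotient.mk_surjective x
    obtain ⟨q, rfl⟩ := Ideal.Quotient.mk_surjective y
    rw [hspan p, hspan q, hxy]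
  let e := LinearEquiv.ofBijective E hbij
  refine ⟨Module.Finite.equiv e.symm, fun t z => ?_⟩
  rw [← det_eq_quarticForm, ← LinearMap.det_conj _ e, ← LinearMap.det_toLin']
  congr 1
  refine LinearMap.ext fun c => ?_
  obtain ⟨x, rfl⟩ := e.surjective c
  have hx : e x = E x := rfl
  simp only [LinearMap.comp_apply, LinearEquiv.coe_coe, LinearEquiv.symm_apply_apply]
  change E (_ * x) = _
  rw [hEmul, hθ', Matrix.toLin'_apply, hx]
  congr 1
  simp [hθu, hθv, hθC, ← hU, ← hV]
  module

end conics

/-! ### Fixed points in homogeneous coordinates -/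

section points

variable {K : Type*} [Field K] {N d : ℕ}

/-- The chosen representative is a unit multiple of `v`, so the same coordinates vanish. This and
the next lemmas make multiplicities and multipliers computable from any normalized representative.
-/
theorem chartIndex_mk {v : Fin (N + 1) → K} (hv : v ≠ 0) {j : Fin (N + 1)} (hj : v j ≠ 0)
    (h : ∀ i, j < i → v i = 0) : chartIndex (Projectivization.mk K v hv : PSpace K N) = j := by
  obtain ⟨a, ha⟩ := Projectivization.exists_smul_eq_mk_rep K v hv
  have hrep (i) : (Projectivization.mk K v hv).rep i = a * v i := by
    rw [← ha]
    rfl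
  refine le_antisymm (Finset.max'_le _ _ _ fun i hi => ?_) (Finset.le_max' _ _ ?_)
  · by_contra hij
    simp [hrep, h i (not_le.mp hij)] at hi
  · simp [hrep, hj]

theorem normRep_mk {v : Fin (N + 1) → K} (hv : v ≠ 0) {j : Fin (N + 1)} (hj : v j = 1)
    (h : ∀ i, j < i → v i = 0) : normRep (Projectivization.mk K v hv : PSpace K N) = v := by
  obtain ⟨a, ha⟩ := Projectivization.exists_smul_eq_mk_rep K v hv
  rw [normRep, chartIndex_mk hv (by simp [hj]) h, ← ha]
  ext i
  simp [hj, Units.smul_def]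

theorem multiplicity_mk (f : ProjEndo K N d) {v : Fin (N + 1) → K} (hv : v ≠ 0)
    {j : Fin (N + 1)} (hj : v j = 1) (h : ∀ i, j < i → v i = 0) :
    f.multiplicity (Projectivization.mk K v hv) =
      Module.finrank K (LocalRingAt (fun i : ChartVar j => v i.1) ⧸
        (f.fixIdeal j).map (algebraMap (MvPolynomial (ChartVar j) K)
          (LocalRingAt (fun i : ChartVar j => v i.1)))) := by
  obtain rfl := chartIndex_mk (N := N) hv (by simp [hj]) h
  have h1 : affineCoords (Projectivization.mk K v hv : PSpace K N) = fun i => v i.1 := by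
    funext i
    simp only [affineCoords]
    rw [normRep_mk hv hj h]
  exact congrArg (fun a : ChartVar (chartIndex (Projectivization.mk K v hv : PSpace K N)) → K =>
    Module.finrank K (LocalRingAt a ⧸ (f.fixIdeal _).map
      (algebraMap (MvPolynomial (ChartVar _) K) (LocalRingAt a)))) h1

theorem multiplierPoly_mk (f : ProjEndo K N d) {v : Fin (N + 1) → K} (hv : v ≠ 0)
    {j : Fin (N + 1)} (hj : v j = 1) (h : ∀ i, j < i → v i = 0) :
    f.multiplierPoly (Projectivization.mk K v hv) =
      (Matrix.of fun k l : ChartVar j =>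
        (eval v (pderiv l.1 (f.coord k.1)) * eval v (f.coord j)
          - eval v (pderiv l.1 (f.coord j)) * eval v (f.coord k.1))
        / eval v (f.coord j) ^ 2).charpoly := by
  obtain rfl := chartIndex_mk (N := N) hv (by simp [hj]) h
  rw [ProjEndo.multiplierPoly]
  congr 1
  ext k l
  simp only [ProjEndo.multiplierMatrix, Matrix.of_apply]
  rw [normRep_mk hv hj h]

theorem charpoly_chartVar_two (j : Fin (2 + 1)) (M : Matrix (ChartVar j) (ChartVar j) K) :
    M.charpoly = Polynomial.X ^ 2
      - Polynomial.C (M (finSuccAboveEquiv j 0) (finSuccAboveEquiv j 0)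
          + M (finSuccAboveEquiv j 1) (finSuccAboveEquiv j 1)) * Polynomial.X
      + Polynomial.C (M (finSuccAboveEquiv j 0) (finSuccAboveEquiv j 0)
          * M (finSuccAboveEquiv j 1) (finSuccAboveEquiv j 1)
          - M (finSuccAboveEquiv j 0) (finSuccAboveEquiv j 1)
          * M (finSuccAboveEquiv j 1) (finSuccAboveEquiv j 0)) := by
  rw [← Matrix.charpoly_reindex (finSuccAboveEquiv j).symm, Matrix.charpoly_fin_two,
    Matrix.trace_fin_two, Matrix.det_fin_two]
  rfl

theorem map_mk_eq_iff (f : ProjEndo K N d) {v : Fin (N + 1) → K} (hv : v ≠ 0) :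
    Projectivization.mk K v hv ∈ f.Fix ↔ ∃ a : K, ∀ i, eval v (f.coord i) = a * v i := by
  obtain ⟨a, ha⟩ := Projectivization.exists_smul_eq_mk_rep K v hv
  have ha0 : (a : K) ≠ 0 := a.ne_zero
  have hrep : (Projectivization.mk K v hv).rep = (a : K) • v := ha.symm
  -- Homogeneity of degree `d`, checked monomial by monomial.
  have h1 (i) : eval ((a : K) • v) (f.coord i) = (a : K) ^ d * eval v (f.coord i) := by
    rw [eval_eq', eval_eq', Finset.mul_sum]
    refine Finset.sum_congr rfl fun m hm => ?_
    have hd : ∑ k, m k = d := by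
      rw [← Finsupp.degree_eq_sum, Finsupp.degree_eq_weight_one]
      exact f.homog i (mem_support_iff.mp hm)
    simp only [Pi.smul_apply, smul_eq_mul, mul_pow, Finset.prod_mul_distrib,
      Finset.prod_pow_eq_pow_sum, hd]
    ring
  rw [ProjEndo.Fix, Set.mem_ofPred_eq, ProjEndo.map, Projectivization.mk_eq_mk_iff']
  simp only [hrep, h1, funext_iff, Pi.smul_apply, smul_eq_mul]
  constructor
  · rintro ⟨b, hb⟩
    exact ⟨b / a ^ d, fun i => by
      have := hb i
      field_simp
      linear_combination -this⟩
  · rintro ⟨b, hb⟩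
    exact ⟨a ^ d * b, fun i => by rw [hb]; ring⟩

/-- A point at which the fixed point scheme is, locally, cut out by the maximal ideal. -/
theorem finrank_eq_one_of_local_equations {ι : Type*} (I : Ideal (MvPolynomial ι K)) (a : ι → K)
    (ha : a ∈ zeroLocus K I)
    (h : ∀ i, algebraMap (MvPolynomial ι K) (LocalRingAt a) (X i - C (a i)) ∈
      I.map (algebraMap (MvPolynomial ι K) (LocalRingAt a))) :
    Module.finrank K (LocalRingAt a ⧸ I.map (algebraMap (MvPolynomial ι K) (LocalRingAt a)))
      = 1 := by
  set J := I.map (algebraMap (MvPolynomial ι K) (LocalRingAt a)) with hJ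
  have hne : J ≠ ⊤ := by
    intro htop
    have h1 : J ≤ IsLocalRing.maximalIdeal (LocalRingAt a) := by
      rw [hJ, Ideal.map_le_iff_le_comap]
      intro p hp
      rw [Ideal.mem_comap, IsLocalization.AtPrime.to_map_mem_maximal_iff (LocalRingAt a)
        (vanishingIdeal K ({a} : Set (ι → K))), mem_vanishingIdeal_singleton_iff]
      exact ha p hp
    exact Ideal.IsPrime.ne_top inferInstance (top_le_iff.mp (htop ▸ h1))
  have : Nontrivial (LocalRingAt a ⧸ J) := Ideal.Quotient.nontrivial_iff.mpr hne
  let π : MvPolynomial ι K →ₐ[K] LocalRingAt a ⧸ J :=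
    (Ideal.Quotient.mkₐ K J).comp (Algebra.algHom K (MvPolynomial ι K) (LocalRingAt a))
  -- Both sides agree on the variables, so modulo `J` a polynomial equals its value at `a`, and a
  -- fraction `p / s` equals the constant `p(a) / s(a)`.
  have hπ : π = (Algebra.ofId K (LocalRingAt a ⧸ J)).comp (aeval a) := by
    ext i
    have h2 := Ideal.Quotient.eq_zero_iff_mem.mpr (h i)
    rw [map_sub, map_sub, sub_eq_zero] at h2
    simp only [AlgHom.comp_apply, aeval_X]
    exact h2
  rw [finrank_eq_one_iff']
  refine ⟨1, one_ne_zero, fun w => ?_⟩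
  obtain ⟨y, rfl⟩ := Ideal.Quotient.mk_surjective w
  obtain ⟨p, s, rfl⟩ := IsLocalization.exists_mk'_eq
    (vanishingIdeal K ({a} : Set (ι → K))).primeCompl y
  have hs : eval a (s : MvPolynomial ι K) ≠ 0 := by
    have := s.2
    rwa [Ideal.mem_primeCompl_iff, mem_vanishingIdeal_singleton_iff] at this
  refine ⟨eval a p / eval a (s : MvPolynomial ι K), ?_⟩
  have h3 : π p = Ideal.Quotient.mk J (IsLocalization.mk' (LocalRingAt a) p s) * π s := by
    change Ideal.Quotient.mk J (algebraMap _ _ p) = _ * Ideal.Quotient.mk J (algebraMap _ _ _)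
    rw [← map_mul, IsLocalization.mk'_spec]
  rw [hπ] at h3
  simp only [AlgHom.comp_apply, aeval_eq_eval, Algebra.ofId_apply] at h3
  refine (Algebra.smul_def _ (1 : LocalRingAt a ⧸ J)).trans ?_
  rw [mul_one, div_eq_mul_inv, map_mul, h3, mul_assoc, ← map_mul,
    mul_inv_cancel₀ hs, map_one, mul_one]

/-- A polynomial that does not vanish at `a` is a unit in the local ring and can be cancelled. -/
theorem mem_map_of_mul_mem {ι : Type*} {I : Ideal (MvPolynomial ι K)} {a : ι → K}
    {s p : MvPolynomial ι K} (hs : eval a s ≠ 0)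
    (h : algebraMap (MvPolynomial ι K) (LocalRingAt a) (s * p) ∈
      I.map (algebraMap (MvPolynomial ι K) (LocalRingAt a))) :
    algebraMap (MvPolynomial ι K) (LocalRingAt a) p ∈
      I.map (algebraMap (MvPolynomial ι K) (LocalRingAt a)) := by
  rw [map_mul] at h
  refine (Ideal.unit_mul_mem_iff_mem _ ?_).mp h
  refine IsLocalization.map_units (LocalRingAt a)
    (⟨s, ?_⟩ : (vanishingIdeal K ({a} : Set (ι → K))).primeCompl)
  rwa [Ideal.mem_primeCompl_iff, mem_vanishingIdeal_singleton_iff]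

end points

/-! ### The fixed points of the normal form -/

section fixedPoints

variable {K : Type*} [Field K] (a₁ a₂ b₁ b₂ : K)

theorem eval_normalForm_zero (v : Fin (2 + 1) → K) :
    eval v ((normalForm a₁ a₂ b₁ b₂).coord 0) =
      v 0 ^ 2 + a₁ * (v 0 * v 2) + a₂ * (v 1 * v 2) - a₁ * v 2 ^ 2 := by
  simp [normalForm, normalFormCoord]

theorem eval_normalForm_one (v : Fin (2 + 1) → K) :
    eval v ((normalForm a₁ a₂ b₁ b₂).coord 1) =
      v 1 ^ 2 + b₁ * (v 0 * v 2) + b₂ * (v 1 * v 2) - b₁ * v 2 ^ 2 := by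
  simp [normalForm, normalFormCoord]

theorem eval_normalForm_two (v : Fin (2 + 1) → K) :
    eval v ((normalForm a₁ a₂ b₁ b₂).coord 2) = v 2 ^ 2 := by
  simp [normalForm, normalFormCoord]

theorem infPoint_ne_zero (b : K) : (![b, 1, 0] : Fin (2 + 1) → K) ≠ 0 := fun h => by
  simpa using congrFun h 1

theorem infPoint'_ne_zero : (![1, 0, 0] : Fin (2 + 1) → K) ≠ 0 := fun h => by
  simpa using congrFun h 0

theorem finPoint_ne_zero (x y : K) : (![x, y, 1] : Fin (2 + 1) → K) ≠ 0 := fun h => by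
  simpa using congrFun h 2

/-- The point `[b : 1 : 0]` of the line at infinity. -/
def infPoint (b : K) : PSpace K 2 := Projectivization.mk K _ (infPoint_ne_zero b)

variable (K) in
/-- The point `[1 : 0 : 0]` of the line at infinity. -/
def infPoint' : PSpace K 2 := Projectivization.mk K _ (infPoint'_ne_zero (K := K))

/-- The point of the affine plane `z = 1` with the given coordinates. -/
def finPoint (p : ChartVar (2 : Fin (2 + 1)) → K) : PSpace K 2 :=
  Projectivization.mk K _ (finPoint_ne_zero (p ⟨0, by decide⟩) (p ⟨1, by decide⟩))

theorem finPoint_injective : Function.Injective (finPoint (K := K)) := by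
  intro p q h
  obtain ⟨c, hc⟩ := (Projectivization.mk_eq_mk_iff' K _ _ _ _).mp h
  have h0 := congrFun hc 0
  have h1 := congrFun hc 1
  have h2 := congrFun hc 2
  simp only [Pi.smul_apply, smul_eq_mul, Matrix.cons_val] at h0 h1 h2
  obtain rfl : c = 1 := by simpa using h2
  funext ⟨i, hi⟩
  fin_cases i
  · simpa using h0.symm
  · simpa using h1.symm
  · exact absurd rfl hi

theorem exists_eq_point (P : PSpace K 2) :
    P = infPoint' K ∨ (∃ b, P = infPoint b) ∨ ∃ p, P = finPoint p := by
  induction P using Projectivization.ind with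
  | h v hv =>
  by_cases h2 : v 2 = 0
  · by_cases h1 : v 1 = 0
    · left
      refine (Projectivization.mk_eq_mk_iff' K _ _ _ _).mpr ⟨v 0, ?_⟩
      ext i
      fin_cases i <;> simp [h1, h2]
    · right; left
      refine ⟨v 0 / v 1, (Projectivization.mk_eq_mk_iff' K _ _ _ _).mpr ⟨v 1, ?_⟩⟩
      ext i
      fin_cases i <;> simp [h2]
      field_simp
  · right; right
    refine ⟨fun i => v i / v 2, (Projectivization.mk_eq_mk_iff' K _ _ _ _).mpr ⟨v 2, ?_⟩⟩
    ext i
    fin_cases i <;> simp <;> field_simp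

theorem infPoint'_mem_fix : infPoint' K ∈ (normalForm a₁ a₂ b₁ b₂).Fix := by
  rw [infPoint', map_mk_eq_iff]
  refine ⟨1, fun i => ?_⟩
  fin_cases i
  · simpa using eval_normalForm_zero a₁ a₂ b₁ b₂ ![1, 0, 0]
  · simpa using eval_normalForm_one a₁ a₂ b₁ b₂ ![1, 0, 0]
  · simpa using eval_normalForm_two a₁ a₂ b₁ b₂ ![1, 0, 0]

/-- On the line at infinity the map is `[x : y] ↦ [x² : y²]`, so the condition is `b² = b`. -/
theorem infPoint_mem_fix_iff (b : K) :
    infPoint b ∈ (normalForm a₁ a₂ b₁ b₂).Fix ↔ b = 0 ∨ b = 1 := by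
  rw [infPoint, map_mk_eq_iff]
  constructor
  · rintro ⟨c, hc⟩
    have h0 := (eval_normalForm_zero a₁ a₂ b₁ b₂ _).symm.trans (hc 0)
    have h1 := (eval_normalForm_one a₁ a₂ b₁ b₂ _).symm.trans (hc 1)
    simp at h0 h1
    rw [← h1, one_mul, pow_two] at h0
    by_cases hb : b = 0
    · exact Or.inl hb
    · exact Or.inr (mul_left_cancel₀ hb (by rw [h0, mul_one]))
  · intro hb
    have hb2 : b ^ 2 = b := by rcases hb with rfl | rfl <;> simp
    refine ⟨1, fun i => ?_⟩
    fin_cases i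
    · simpa [hb2] using eval_normalForm_zero a₁ a₂ b₁ b₂ ![b, 1, 0]
    · simpa using eval_normalForm_one a₁ a₂ b₁ b₂ ![b, 1, 0]
    · simpa using eval_normalForm_two a₁ a₂ b₁ b₂ ![b, 1, 0]

theorem fixIdeal_two_eq : (normalForm a₁ a₂ b₁ b₂).fixIdeal 2 = Ideal.span
    {X ⟨0, by decide⟩ ^ 2 + C a₁ * X ⟨0, by decide⟩ + C a₂ * X ⟨1, by decide⟩ - C a₁
      - X ⟨0, by decide⟩,
     X ⟨1, by decide⟩ ^ 2 + C b₁ * X ⟨0, by decide⟩ + C b₂ * X ⟨1, by decide⟩ - C b₁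
      - X ⟨1, by decide⟩} := by
  rw [ProjEndo.fixIdeal]
  congr 1
  have h (f : ChartVar (2 : Fin (2 + 1)) → MvPolynomial (ChartVar (2 : Fin (2 + 1))) K) :
      Set.range f = {f ⟨0, by decide⟩, f ⟨1, by decide⟩} := by
    ext p
    constructor
    · rintro ⟨⟨i, hi⟩, rfl⟩
      fin_cases i
      · exact Or.inl rfl
      · exact Or.inr rfl
      · exact absurd rfl hi
    · rintro (rfl | rfl) <;> exact ⟨_, rfl⟩
  rw [h]
  simp [normalForm, normalFormCoord, dehomogenize]

theorem finPoint_mem_fix_iff (p : ChartVar (2 : Fin (2 + 1)) → K) :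
    finPoint p ∈ (normalForm a₁ a₂ b₁ b₂).Fix ↔
      p ∈ zeroLocus K ((normalForm a₁ a₂ b₁ b₂).fixIdeal 2) := by
  rw [fixIdeal_two_eq, zeroLocus_span, finPoint, map_mk_eq_iff]
  simp only [Fin.forall_fin_succ, Fin.succ_zero_eq_one, Fin.succ_one_eq_two]
  simp [eval_normalForm_zero, eval_normalForm_one, eval_normalForm_two,
    sub_eq_zero, aeval_eq_eval]

end fixedPoints

/-! ### Multipliers and multiplicities of the fixed points -/

section multipliers

variable {K : Type*} [Field K] (a₁ a₂ b₁ b₂ : K)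

theorem multiplierPoly_infPoint' :
    (normalForm a₁ a₂ b₁ b₂).multiplierPoly (infPoint' K) = Polynomial.X ^ 2 := by
  rw [infPoint', multiplierPoly_mk (j := 0) _ _ (by simp)
    (by intro i hi; fin_cases i <;> simp at hi ⊢), charpoly_chartVar_two]
  simp [normalForm, normalFormCoord, finSuccAboveEquiv_apply, Fin.succAbove, pderiv_X,
    Pi.single_apply]

theorem multiplierPoly_infPoint (b : K) :
    (normalForm a₁ a₂ b₁ b₂).multiplierPoly (infPoint b) =
      Polynomial.X ^ 2 - Polynomial.C (2 * b) * Polynomial.X := by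
  rw [infPoint, multiplierPoly_mk (j := 1) _ _ (by simp)
    (by intro i hi; fin_cases i <;> simp at hi ⊢), charpoly_chartVar_two]
  simp [normalForm, normalFormCoord, finSuccAboveEquiv_apply, Fin.succAbove, pderiv_X,
    Pi.single_apply]

theorem multiplierPoly_finPoint (p : ChartVar (2 : Fin (2 + 1)) → K) :
    (normalForm a₁ a₂ b₁ b₂).multiplierPoly (finPoint p) =
      Polynomial.X ^ 2 - Polynomial.C ((2 * p ⟨0, by decide⟩ + a₁)
        + (2 * p ⟨1, by decide⟩ + b₂)) * Polynomial.X
      + Polynomial.C ((2 * p ⟨0, by decide⟩ + a₁) * (2 * p ⟨1, by decide⟩ + b₂) - a₂ * b₁) := by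
  rw [finPoint, multiplierPoly_mk (j := 2) _ _ (by simp)
    (by intro i hi; fin_cases i <;> simp at hi ⊢), charpoly_chartVar_two]
  simp [normalForm, normalFormCoord, finSuccAboveEquiv_apply, Fin.succAbove, pderiv_X,
    Pi.single_apply]

theorem multiplicity_finPoint (p : ChartVar (2 : Fin (2 + 1)) → K) :
    (normalForm a₁ a₂ b₁ b₂).multiplicity (finPoint p) =
      Module.finrank K (LocalRingAt p ⧸ ((normalForm a₁ a₂ b₁ b₂).fixIdeal 2).map
        (algebraMap (MvPolynomial (ChartVar (2 : Fin (2 + 1))) K) (LocalRingAt p))) := by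
  rw [finPoint, multiplicity_mk (j := 2) _ _ (by simp)
    (by intro i hi; fin_cases i <;> simp at hi ⊢)]
  have : (fun i : ChartVar (2 : Fin (2 + 1)) => (![p ⟨0, by decide⟩, p ⟨1, by decide⟩, 1] :
      Fin (2 + 1) → K) i.1) = p := by
    funext ⟨i, hi⟩
    fin_cases i
    · rfl
    · rfl
    · exact absurd rfl hi
  exact congrArg (fun a : ChartVar (2 : Fin (2 + 1)) → K =>
    Module.finrank K (LocalRingAt a ⧸ ((normalForm a₁ a₂ b₁ b₂).fixIdeal 2).map
      (algebraMap (MvPolynomial (ChartVar _) K) (LocalRingAt a)))) this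

/-- The equations are `z (z - f₀)` and, modulo `z`, `y (y - f₀)`. Since `f₀ = 1` at the point, both
second factors are local units and the equations cut out the maximal ideal. -/
theorem multiplicity_infPoint' :
    (normalForm a₁ a₂ b₁ b₂).multiplicity (infPoint' K) = 1 := by
  rw [infPoint', multiplicity_mk (j := 0) _ _ (by simp)
    (by intro i hi; fin_cases i <;> simp at hi ⊢)]
  set I := (normalForm a₁ a₂ b₁ b₂).fixIdeal 0 with hI
  set a : ChartVar (0 : Fin (2 + 1)) → K := fun i => (![1, 0, 0] : Fin (2 + 1) → K) i.1 with ha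
  have ha1 : a ⟨1, by decide⟩ = 0 := by simp [ha]
  have ha2 : a ⟨2, by decide⟩ = 0 := by simp [ha]
  let y : MvPolynomial (ChartVar (0 : Fin (2 + 1))) K := X ⟨1, by decide⟩
  let z : MvPolynomial (ChartVar (0 : Fin (2 + 1))) K := X ⟨2, by decide⟩
  let f₀ : MvPolynomial (ChartVar (0 : Fin (2 + 1))) K :=
    1 + C a₁ * z + C a₂ * (y * z) - C a₁ * z ^ 2
  have g1 : y ^ 2 + C b₁ * z + C b₂ * (y * z) - C b₁ * z ^ 2 - y * f₀ ∈ I := by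
    refine Ideal.subset_span ⟨⟨1, by decide⟩, ?_⟩
    simp [normalForm, normalFormCoord, dehomogenize, y, z, f₀]
  have g2 : z ^ 2 - z * f₀ ∈ I := by
    refine Ideal.subset_span ⟨⟨2, by decide⟩, ?_⟩
    simp [normalForm, normalFormCoord, dehomogenize, y, z, f₀]
  have hz : algebraMap _ (LocalRingAt a) z ∈ I.map (algebraMap _ (LocalRingAt a)) := by
    refine mem_map_of_mul_mem (s := z - f₀) ?_ ?_
    · simp [y, z, f₀, ha1, ha2]
    · rw [show (z - f₀) * z = z ^ 2 - z * f₀ by ring]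
      exact Ideal.mem_map_of_mem _ g2
  have hy : algebraMap _ (LocalRingAt a) y ∈ I.map (algebraMap _ (LocalRingAt a)) := by
    refine mem_map_of_mul_mem (s := y - f₀) ?_ ?_
    · simp [y, z, f₀, ha1, ha2]
    · rw [show (y - f₀) * y = (y ^ 2 + C b₁ * z + C b₂ * (y * z) - C b₁ * z ^ 2 - y * f₀)
        - (C b₁ + C b₂ * y - C b₁ * z) * z by ring, map_sub, map_mul]
      exact Ideal.sub_mem _ (Ideal.mem_map_of_mem _ g1) (Ideal.mul_mem_left _ _ hz)
  refine finrank_eq_one_of_local_equations I a ?_ ?_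
  · rw [hI, ProjEndo.fixIdeal, zeroLocus_span]
    rintro _ ⟨⟨i, hi⟩, rfl⟩
    fin_cases i
    · exact absurd rfl hi
    · simp [normalForm, normalFormCoord, dehomogenize, aeval_eq_eval, ha1, ha2]
    · simp [normalForm, normalFormCoord, dehomogenize, aeval_eq_eval, ha1, ha2]
  · rintro ⟨i, hi⟩
    fin_cases i
    · exact absurd rfl hi
    · simpa only [Fin.mk_one, ha1, C_0, sub_zero] using hy
    · simpa only [Fin.reduceFinMk, ha2, C_0, sub_zero] using hz

theorem multiplicity_infPoint {b : K} (hb : b = 0 ∨ b = 1) :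
    (normalForm a₁ a₂ b₁ b₂).multiplicity (infPoint b) = 1 := by
  have hb2 : b ^ 2 = b := by rcases hb with rfl | rfl <;> simp
  have hb3 : b + b - 1 ≠ 0 := by rcases hb with rfl | rfl <;> simp
  rw [infPoint, multiplicity_mk (j := 1) _ _ (by simp)
    (by intro i hi; fin_cases i <;> simp at hi ⊢)]
  set I := (normalForm a₁ a₂ b₁ b₂).fixIdeal 1 with hI
  set a : ChartVar (1 : Fin (2 + 1)) → K := fun i => (![b, 1, 0] : Fin (2 + 1) → K) i.1 with ha
  have ha0 : a ⟨0, by decide⟩ = b := by simp [ha]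
  have ha2 : a ⟨2, by decide⟩ = 0 := by simp [ha]
  let x : MvPolynomial (ChartVar (1 : Fin (2 + 1))) K := X ⟨0, by decide⟩
  let z : MvPolynomial (ChartVar (1 : Fin (2 + 1))) K := X ⟨2, by decide⟩
  let f₁ : MvPolynomial (ChartVar (1 : Fin (2 + 1))) K :=
    1 + C b₁ * (x * z) + C b₂ * z - C b₁ * z ^ 2
  have g0 : x ^ 2 + C a₁ * (x * z) + C a₂ * z - C a₁ * z ^ 2 - x * f₁ ∈ I := by
    refine Ideal.subset_span ⟨⟨0, by decide⟩, ?_⟩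
    simp [normalForm, normalFormCoord, dehomogenize, x, z, f₁]
  have g2 : z ^ 2 - z * f₁ ∈ I := by
    refine Ideal.subset_span ⟨⟨2, by decide⟩, ?_⟩
    simp [normalForm, normalFormCoord, dehomogenize, x, z, f₁]
  have hz : algebraMap _ (LocalRingAt a) z ∈ I.map (algebraMap _ (LocalRingAt a)) := by
    refine mem_map_of_mul_mem (s := z - f₁) ?_ ?_
    · simp [x, z, f₁, ha0, ha2]
    · rw [show (z - f₁) * z = z ^ 2 - z * f₁ by ring]
      exact Ideal.mem_map_of_mem _ g2
  -- Modulo `z` the remaining equation is `x² - x = (x + b - 1)(x - b)`, as `b² = b`; the first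
  -- factor has value `2b - 1 = ±1` at the point.
  have hx : algebraMap _ (LocalRingAt a) (x - C b) ∈ I.map (algebraMap _ (LocalRingAt a)) := by
    refine mem_map_of_mul_mem (s := x + C b - 1) ?_ ?_
    · simpa [x, z, ha0, ha2] using hb3
    · have hC : (C b : MvPolynomial (ChartVar (1 : Fin (2 + 1))) K) ^ 2 = C b := by
        rw [← C_pow, hb2]
      rw [show (x + C b - 1) * (x - C b)
        = (x ^ 2 + C a₁ * (x * z) + C a₂ * z - C a₁ * z ^ 2 - x * f₁)
        - (C a₁ * x + C a₂ - C a₁ * z - x * (C b₁ * x + C b₂ - C b₁ * z)) * z by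
          linear_combination -hC, map_sub, map_mul]
      exact Ideal.sub_mem _ (Ideal.mem_map_of_mem _ g0) (Ideal.mul_mem_left _ _ hz)
  refine finrank_eq_one_of_local_equations I a ?_ ?_
  · rw [hI, ProjEndo.fixIdeal, zeroLocus_span]
    rintro _ ⟨⟨i, hi⟩, rfl⟩
    fin_cases i
    · simp [normalForm, normalFormCoord, dehomogenize, aeval_eq_eval, ha0, ha2, hb2]
    · exact absurd rfl hi
    · simp [normalForm, normalFormCoord, dehomogenize, aeval_eq_eval, ha0, ha2]
  · rintro ⟨i, hi⟩
    fin_cases i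
    · simpa only [Fin.zero_eta, ha0] using hx
    · exact absurd rfl hi
    · simpa only [Fin.reduceFinMk, ha2, C_0, sub_zero] using hz

end multipliers

/-! ### The polynomial `Σ_1` of the normal form -/

section sigma

theorem polynomial_polynomial_ext {K : Type*} [Field K] [Infinite K]
    {F G : Polynomial (Polynomial K)}
    (h : ∀ t w : K, ((F.map (Polynomial.evalRingHom t)).eval w)
      = ((G.map (Polynomial.evalRingHom t)).eval w)) : F = G := by
  have h1 (t : K) : F.map (Polynomial.evalRingHom t) = G.map (Polynomial.evalRingHom t) :=
    Polynomial.funext (h t)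
  ext1 k
  refine Polynomial.funext fun t => ?_
  have := congrArg (fun p => Polynomial.coeff p k) (h1 t)
  simpa using this

/-- The polynomial `Σ_1` of a normal form in terms of the invariants `q`, `s`, `c`, `r`, `n`. -/
def sigmaForm {R : Type*} [CommRing R] (q s c r n t w : R) : R :=
  (w - t ^ 2) ^ 2 * (w - t ^ 2 + 2 * t) * quarticForm q s c r n t (w - t ^ 2)

theorem map_quarticForm {R S : Type*} [CommRing R] [CommRing S] (f : R →+* S)
    (q s c r n t z : R) : f (quarticForm q s c r n t z) =
      quarticForm (f q) (f s) (f c) (f r) (f n) (f t) (f z) := by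
  simp only [quarticForm, map_add, map_sub, map_mul, map_pow, map_neg, map_one, map_ofNat]

theorem map_sigmaForm {R S : Type*} [CommRing R] [CommRing S] (f : R →+* S)
    (q s c r n t w : R) : f (sigmaForm q s c r n t w) =
      sigmaForm (f q) (f s) (f c) (f r) (f n) (f t) (f w) := by
  simp only [sigmaForm, map_quarticForm, map_add, map_sub, map_mul, map_pow, map_ofNat]

variable {K : Type*} [Field K]

theorem fix_normalForm (a₁ a₂ b₁ b₂ : K) :
    (normalForm a₁ a₂ b₁ b₂).Fix = {infPoint' K, infPoint 0, infPoint 1} ∪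
      finPoint '' zeroLocus K ((normalForm a₁ a₂ b₁ b₂).fixIdeal 2) := by
  ext P
  constructor
  · intro hP
    obtain rfl | ⟨b, rfl⟩ | ⟨p, rfl⟩ := exists_eq_point P
    · simp
    · rcases (infPoint_mem_fix_iff a₁ a₂ b₁ b₂ b).mp hP with rfl | rfl <;> simp
    · exact Or.inr ⟨p, (finPoint_mem_fix_iff a₁ a₂ b₁ b₂ p).mp hP, rfl⟩
  · rintro ((rfl | rfl | rfl) | ⟨p, hp, rfl⟩)
    · exact infPoint'_mem_fix a₁ a₂ b₁ b₂
    · simp [infPoint_mem_fix_iff]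
    · simp [infPoint_mem_fix_iff]
    · exact (finPoint_mem_fix_iff a₁ a₂ b₁ b₂ p).mpr hp

theorem infPoint_ne_infPoint' (b : K) : infPoint' K ≠ infPoint b := by
  intro h
  obtain ⟨c, hc⟩ := (Projectivization.mk_eq_mk_iff' K _ _ _ _).mp h
  have h0 := congrFun hc 0
  have h1 := congrFun hc 1
  simp at h0 h1
  simp [h1] at h0

theorem infPoint_injective : Function.Injective (infPoint (K := K)) := by
  intro b b' h
  obtain ⟨c, hc⟩ := (Projectivization.mk_eq_mk_iff' K _ _ _ _).mp h
  have h0 := congrFun hc 0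
  have h1 := congrFun hc 1
  simp at h0 h1
  simpa [h1] using h0.symm

theorem infPoint'_ne_finPoint (p : ChartVar (2 : Fin (2 + 1)) → K) : infPoint' K ≠ finPoint p := by
  intro h
  obtain ⟨c, hc⟩ := (Projectivization.mk_eq_mk_iff' K _ _ _ _).mp h
  have h0 := congrFun hc 0
  have h2 := congrFun hc 2
  simp at h0 h2
  simp [h2] at h0

theorem infPoint_ne_finPoint (b : K) (p : ChartVar (2 : Fin (2 + 1)) → K) :
    infPoint b ≠ finPoint p := by
  intro h
  obtain ⟨c, hc⟩ := (Projectivization.mk_eq_mk_iff' K _ _ _ _).mp h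
  have h1 := congrFun hc 1
  have h2 := congrFun hc 2
  simp at h1 h2
  simp [h2] at h1

variable [CharZero K]

/-- The fixed point scheme in the affine plane, in the coordinates `u = 2x + a₁`, `v = 2y + b₂`. -/
theorem fixIdeal_two_eq_conics (a₁ a₂ b₁ b₂ : K)
    (u v : MvPolynomial (ChartVar (2 : Fin (2 + 1))) K)
    (hu : u = 2 * X ⟨0, by decide⟩ + C a₁) (hv : v = 2 * X ⟨1, by decide⟩ + C b₂) :
    (normalForm a₁ a₂ b₁ b₂).fixIdeal 2 = Ideal.span
      {u ^ 2 - 2 * u + 2 * C a₂ * v - C (a₁ ^ 2 + 2 * a₁ + 2 * a₂ * b₂),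
        v ^ 2 - 2 * v + 2 * C b₁ * u - C (b₂ ^ 2 - 2 * b₂ + 2 * a₁ * b₁ + 4 * b₁)} := by
  rw [fixIdeal_two_eq]
  -- The equations in `u, v` are four times those in `x, y`, and `4` is a unit.
  have h4 : (C (4 : K)⁻¹ : MvPolynomial (ChartVar (2 : Fin (2 + 1))) K) * 4 = 1 := by
    rw [← map_ofNat C 4, ← C_mul, inv_mul_cancel₀ (by norm_num), C_1]
  have hC2 : (C 2 : MvPolynomial (ChartVar (2 : Fin (2 + 1))) K) = 2 := map_ofNat C 2
  have hC4 : (C 4 : MvPolynomial (ChartVar (2 : Fin (2 + 1))) K) = 4 := map_ofNat C 4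
  set x : MvPolynomial (ChartVar (2 : Fin (2 + 1))) K := X ⟨0, by decide⟩
  set y : MvPolynomial (ChartVar (2 : Fin (2 + 1))) K := X ⟨1, by decide⟩
  have e1 : u ^ 2 - 2 * u + 2 * C a₂ * v - C (a₁ ^ 2 + 2 * a₁ + 2 * a₂ * b₂)
      = 4 * (x ^ 2 + C a₁ * x + C a₂ * y - C a₁ - x) := by
    rw [hu, hv]
    simp only [C_add, C_mul, C_pow, hC2]
    ring
  have e2 : v ^ 2 - 2 * v + 2 * C b₁ * u - C (b₂ ^ 2 - 2 * b₂ + 2 * a₁ * b₁ + 4 * b₁)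
      = 4 * (y ^ 2 + C b₁ * x + C b₂ * y - C b₁ - y) := by
    rw [hu, hv]
    simp only [C_add, C_sub, C_mul, C_pow, hC2, hC4]
    ring
  rw [e1, e2]
  have hun : IsUnit (4 : MvPolynomial (ChartVar (2 : Fin (2 + 1))) K) :=
    IsUnit.of_mul_eq_one_right _ h4
  rw [Ideal.span_insert, Ideal.span_insert, Ideal.span_singleton_mul_left_unit hun,
    Ideal.span_singleton_mul_left_unit hun]

variable [IsAlgClosed K]

/-- The multipliers at infinity, `t²`, `t²` and `t² - 2t`, give the outer factors; the affine points
give the norm computed in `det_lmul_conics`, compared at each pair `(t, w)`. Here `A` and `B` exceed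
the constants of the conics by `1`. -/
theorem sigma1_normalForm (a₁ a₂ b₁ b₂ : K) (A B : K)
    (hA : A = a₁ ^ 2 + 2 * a₁ + 2 * a₂ * b₂ + 1)
    (hB : B = b₂ ^ 2 - 2 * b₂ + 2 * a₁ * b₁ + 4 * b₁ + 1) :
    (normalForm a₁ a₂ b₁ b₂).Sigma1 =
      sigmaForm (.C (.C (a₂ * b₁))) (.C (.C (a₂ + b₁))) (.C (.C (A + B - 2 * (a₂ + b₁))))
        (.C (.C (a₂ * B + b₁ * A))) (.C (.C (A * B))) (.C .X) .X := by
  classical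
  set f := normalForm a₁ a₂ b₁ b₂ with hf
  set I := f.fixIdeal 2 with hI
  let u : MvPolynomial (ChartVar (2 : Fin (2 + 1))) K := 2 * X ⟨0, by decide⟩ + C a₁
  let v : MvPolynomial (ChartVar (2 : Fin (2 + 1))) K := 2 * X ⟨1, by decide⟩ + C b₂
  obtain ⟨hfin, hdet⟩ := det_lmul_conics (i₀ := (⟨0, by decide⟩ : ChartVar (2 : Fin (2 + 1))))
    (i₁ := ⟨1, by decide⟩) (by
      rintro ⟨i, hi⟩
      fin_cases i
      · exact Or.inl rfl
      · exact Or.inr rfl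
      · exact absurd rfl hi) (by decide) a₁ b₂ a₂ b₁ _ _ u v rfl rfl I
    (fixIdeal_two_eq_conics a₁ a₂ b₁ b₂ u v rfl rfl)
  have hZ : (zeroLocus K I).Finite := finite_zeroLocus I
  have hfact : f.Sigma1 = (Polynomial.X - Polynomial.C (Polynomial.X ^ 2)) ^ 2 *
      (Polynomial.X - Polynomial.C (Polynomial.X ^ 2) + 2 * Polynomial.C Polynomial.X) *
      ∏ᶠ p ∈ zeroLocus K I, (Polynomial.X - Polynomial.C (f.multiplierPoly (finPoint p))) ^
        Module.finrank K (LocalRingAt p ⧸ I.map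
          (algebraMap (MvPolynomial (ChartVar (2 : Fin (2 + 1))) K) (LocalRingAt p))) := by
    rw [ProjEndo.Sigma1, hf, fix_normalForm, ← hf, ← hI, finprod_mem_union ?_ (Set.toFinite _)
      (hZ.image _), finprod_mem_image finPoint_injective.injOn]
    · congr 1
      · rw [finprod_mem_insert _ (by simp [infPoint_ne_infPoint']) (Set.toFinite _),
          finprod_mem_pair (infPoint_injective.ne zero_ne_one), multiplierPoly_infPoint',
          multiplierPoly_infPoint, multiplierPoly_infPoint, multiplicity_infPoint',
          multiplicity_infPoint _ _ _ _ (Or.inl rfl), multiplicity_infPoint _ _ _ _ (Or.inr rfl)]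
        simp only [mul_zero, mul_one, Polynomial.C_0, zero_mul, sub_zero, pow_one, map_sub,
          map_mul, map_ofNat]
        ring
      · refine finprod_mem_congr rfl fun p _ => ?_
        rw [multiplicity_finPoint]
    · rw [Set.disjoint_left]
      rintro _ (rfl | rfl | rfl) ⟨p, _, hp⟩
      · exact infPoint'_ne_finPoint p hp.symm
      · exact infPoint_ne_finPoint _ p hp.symm
      · exact infPoint_ne_finPoint _ p hp.symm
  refine polynomial_polynomial_ext fun t w => ?_
  let φ : Polynomial (Polynomial K) →+* K :=
    (Polynomial.evalRingHom w).comp (Polynomial.mapRingHom (Polynomial.evalRingHom t))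
  have hφ (F : Polynomial (Polynomial K)) :
      (F.map (Polynomial.evalRingHom t)).eval w = φ F := rfl
  have hφX : φ .X = w := by simp [φ]
  have hφt : φ (.C .X) = t := by simp [φ]
  have hφC (k : K) : φ (.C (.C k)) = k := by simp [φ]
  rw [hφ, hφ, map_sigmaForm, hφX, hφt, hφC, hφC, hφC, hφC, hφC, hfact, sigmaForm, map_mul]
  congr 1
  · simp [φ]
  · have hA' : A = a₁ ^ 2 + 2 * a₁ + 2 * a₂ * b₂ + 1 := hA
    rw [hA, hB, ← hdet t (w - t ^ 2), det_lmul_mk, finprod_mem_eq_finite_toFinset_prod _ hZ,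
      finprod_mem_eq_finite_toFinset_prod _ hZ, map_prod]
    refine Finset.prod_congr rfl fun p _ => ?_
    rw [map_pow, hf, multiplierPoly_finPoint]
    congr 1
    simp [φ, u, v]
    ring

end sigma

/-! ### The multiplier invariants as polynomials -/

section invariants

/-- The coordinates of `φ` only involve the coefficients of `w⁶`, `w⁵`, `w⁴`, so the lower ones stay
unnamed. -/
theorem exists_sigmaForm_eq {T : Type*} [CommRing T] (q s c r n t : T) :
    ∃ r₀ r₁ r₂ r₃ : T, sigmaForm (.C q) (.C s) (.C c) (.C r) (.C n) (.C t) .X =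
      (.X ^ 7 + .C ((-8 * q - 4 + 8 * t) - 7 * t ^ 2 + 2 * t) * .X ^ 6
      + .C (((18 * q ^ 2 - 2 * c - 2 * n - 28 * q + 12 * r + 6) + (4 * c + 8 * q - 8 * r - 24) * t
            + (-2 * c - 12 * q + 24) * t ^ 2)
          + (-8 * q - 4 + 8 * t) * (2 * t - 6 * t ^ 2) + 21 * t ^ 4 - 12 * t ^ 3) * .X ^ 5
      + .C (((-40 * c * q + 8 * c * r - 8 * n * s - 24 * q * r - 24 * q * s + 84 * q ^ 2
              + 16 * r * s + 4 * c - 4 * n + 16 * q - 4)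
            + (48 * c * q - 8 * c * r + 8 * n * s + 24 * q * r + 8 * q * s - 72 * q ^ 2
              - 16 * r * s - 16 * c + 8 * n - 64 * q + 8 * r + 24) * t
            + (-8 * c * q + 24 * q * s + 24 * q ^ 2 + 20 * c - 8 * n + 24 * q + 8 * r - 48) * t ^ 2
            + (-8 * q * s - 8 * c - 16 * q - 8 * r + 32) * t ^ 3)
          + ((18 * q ^ 2 - 2 * c - 2 * n - 28 * q + 12 * r + 6)
            + (4 * c + 8 * q - 8 * r - 24) * t + (-2 * c - 12 * q + 24) * t ^ 2)
            * (2 * t - 5 * t ^ 2)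
          + (-8 * q - 4 + 8 * t) * (15 * t ^ 4 - 10 * t ^ 3) - 35 * t ^ 6 + 30 * t ^ 5) * .X ^ 4
      + .C r₃ * .X ^ 3 + .C r₂ * .X ^ 2 + .C r₁ * .X + .C r₀ : Polynomial T) := by
  -- Treating the coefficients of the quartic in `z` as opaque keeps the expansion at `z = w - t²`
  -- small.
  obtain ⟨c₁, h₁⟩ : ∃ c₁, c₁ = -8 * q - 4 + 8 * t := ⟨_, rfl⟩
  obtain ⟨c₂, h₂⟩ : ∃ c₂, c₂ = (18 * q ^ 2 - 2 * c - 2 * n - 28 * q + 12 * r + 6)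
    + (4 * c + 8 * q - 8 * r - 24) * t + (-2 * c - 12 * q + 24) * t ^ 2 := ⟨_, rfl⟩
  obtain ⟨c₃, h₃⟩ : ∃ c₃, c₃ = (-40 * c * q + 8 * c * r - 8 * n * s - 24 * q * r - 24 * q * s
      + 84 * q ^ 2 + 16 * r * s + 4 * c - 4 * n + 16 * q - 4)
    + (48 * c * q - 8 * c * r + 8 * n * s + 24 * q * r + 8 * q * s - 72 * q ^ 2
      - 16 * r * s - 16 * c + 8 * n - 64 * q + 8 * r + 24) * t
    + (-8 * c * q + 24 * q * s + 24 * q ^ 2 + 20 * c - 8 * n + 24 * q + 8 * r - 48) * t ^ 2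
    + (-8 * q * s - 8 * c - 16 * q - 8 * r + 32) * t ^ 3 := ⟨_, rfl⟩
  obtain ⟨c₄, h₄⟩ : ∃ c₄, c₄ = quarticForm q s c r n t 0 := ⟨_, rfl⟩
  have hz (z : Polynomial T) :
      quarticForm (.C q) (.C s) (.C c) (.C r) (.C n) (.C t) z =
        z ^ 4 + .C c₁ * z ^ 3 + .C c₂ * z ^ 2 + .C c₃ * z + .C c₄ := by
    rw [h₄, map_quarticForm, h₁, h₂, h₃]
    simp only [quarticForm, map_add, map_sub, map_mul, map_pow, map_neg, map_ofNat,
      map_zero]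
    ring
  rw [← h₁, ← h₂, ← h₃, sigmaForm, hz]
  refine ⟨-t ^ 14 + c₁ * t ^ 12 + 2 * t ^ 13 - 2 * c₁ * t ^ 11 - c₂ * t ^ 10 + 2 * c₂ * t ^ 9
      + c₃ * t ^ 8 - 2 * c₃ * t ^ 7 - c₄ * t ^ 6 + 2 * c₄ * t ^ 5,
    7 * t ^ 12 - 6 * c₁ * t ^ 10 - 12 * t ^ 11 + 10 * c₁ * t ^ 9 + 5 * c₂ * t ^ 8 - 8 * c₂ * t ^ 7
      - 4 * c₃ * t ^ 6 + 6 * c₃ * t ^ 5 + 3 * c₄ * t ^ 4 - 4 * c₄ * t ^ 3,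
    -21 * t ^ 10 + 15 * c₁ * t ^ 8 + 30 * t ^ 9 - 20 * c₁ * t ^ 7 - 10 * c₂ * t ^ 6
      + 12 * c₂ * t ^ 5 + 6 * c₃ * t ^ 4 - 6 * c₃ * t ^ 3 - 3 * c₄ * t ^ 2 + 2 * c₄ * t,
    35 * t ^ 8 - 20 * c₁ * t ^ 6 - 40 * t ^ 7 + 20 * c₁ * t ^ 5 + 10 * c₂ * t ^ 4 - 8 * c₂ * t ^ 3
      - 4 * c₃ * t ^ 2 + 2 * c₃ * t + c₄, ?_⟩
  simp only [map_add, map_sub, map_mul, map_pow, map_neg, map_ofNat]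
  ring

section coeff

variable {R : Type*} [CommRing R] (q s c r n : R)

theorem coeff_six_sigmaForm :
    (sigmaForm (.C (.C q)) (.C (.C s)) (.C (.C c)) (.C (.C r)) (.C (.C n)) (.C .X) .X :
      Polynomial (Polynomial R)).coeff 6 =
    .C (-8 * q - 4) + .C 10 * .X + .C (-7) * .X ^ 2 := by
  obtain ⟨r₀, r₁, r₂, r₃, h⟩ := exists_sigmaForm_eq (T := Polynomial R) (.C q) (.C s) (.C c)
    (.C r) (.C n) .X
  rw [h]
  simp only [Polynomial.coeff_add, Polynomial.coeff_C_mul, Polynomial.coeff_X_pow,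
    Polynomial.coeff_X, Polynomial.coeff_C]
  norm_num
  simp only [map_ofNat]
  ring

theorem coeff_five_sigmaForm :
    (sigmaForm (.C (.C q)) (.C (.C s)) (.C (.C c)) (.C (.C r)) (.C (.C n)) (.C .X) .X :
      Polynomial (Polynomial R)).coeff 5 =
    .C (6 - 28 * q - 2 * c + 12 * r - 2 * n + 18 * q ^ 2)
      + .C (-(32 + 8 * q - 4 * c + 8 * r)) * .X
      + .C (64 + 36 * q - 2 * c) * .X ^ 2 + .C (-60) * .X ^ 3 + .C 21 * .X ^ 4 := by
  obtain ⟨r₀, r₁, r₂, r₃, h⟩ := exists_sigmaForm_eq (T := Polynomial R) (.C q) (.C s) (.C c)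
    (.C r) (.C n) .X
  rw [h]
  simp only [Polynomial.coeff_add, Polynomial.coeff_C_mul, Polynomial.coeff_X_pow,
    Polynomial.coeff_X, Polynomial.coeff_C]
  norm_num
  simp only [map_ofNat]
  ring

theorem coeff_three_coeff_four_sigmaForm :
    ((sigmaForm (.C (.C q)) (.C (.C s)) (.C (.C c)) (.C (.C r)) (.C (.C n)) (.C .X) .X :
      Polynomial (Polynomial R)).coeff 4).coeff 3 = 240 - 32 * c + 32 * r - 8 * (q * s) := by
  obtain ⟨r₀, r₁, r₂, r₃, h⟩ := exists_sigmaForm_eq (T := Polynomial R) (.C q) (.C s) (.C c)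
    (.C r) (.C n) .X
  obtain ⟨d₀, d₁, d₂, d₄, d₅, d₆, hd⟩ : ∃ d₀ d₁ d₂ d₄ d₅ d₆ : R,
      (sigmaForm (.C (.C q)) (.C (.C s)) (.C (.C c)) (.C (.C r)) (.C (.C n)) (.C .X) .X :
        Polynomial (Polynomial R)).coeff 4 =
      .C d₀ + .C d₁ * .X + .C d₂ * .X ^ 2 + .C (240 - 32 * c + 32 * r - 8 * (q * s)) * .X ^ 3
        + .C d₄ * .X ^ 4 + .C d₅ * .X ^ 5 + .C d₆ * .X ^ 6 := by
    refine ⟨-40 * c * q + 8 * c * r - 8 * n * s - 24 * q * r - 24 * q * s + 84 * q ^ 2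
        + 16 * r * s + 4 * c - 4 * n + 16 * q - 4,
      2 * (18 * q ^ 2 - 2 * c - 2 * n - 28 * q + 12 * r + 6) + (48 * c * q - 8 * c * r + 8 * n * s
        + 24 * q * r + 8 * q * s - 72 * q ^ 2
        - 16 * r * s - 16 * c + 8 * n - 64 * q + 8 * r + 24),
      -5 * (18 * q ^ 2 - 2 * c - 2 * n - 28 * q + 12 * r + 6)
        + 2 * (4 * c + 8 * q - 8 * r - 24)
        + (-8 * c * q + 24 * q * s + 24 * q ^ 2 + 20 * c - 8 * n + 24 * q + 8 * r - 48),
      15 * (-8 * q - 4) - 80 - 5 * (-2 * c - 12 * q + 24), 150, -35, ?_⟩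
    rw [h]
    simp only [Polynomial.coeff_add, Polynomial.coeff_C_mul, Polynomial.coeff_X_pow,
      Polynomial.coeff_X, Polynomial.coeff_C]
    norm_num
    simp only [map_ofNat]
    ring
  rw [hd]
  simp only [Polynomial.coeff_add, Polynomial.coeff_C_mul, Polynomial.coeff_X_pow,
    Polynomial.coeff_X, Polynomial.coeff_C]
  norm_num

theorem coeff_zero_coeff_six_sigmaForm :
    ((sigmaForm (.C (.C q)) (.C (.C s)) (.C (.C c)) (.C (.C r)) (.C (.C n)) (.C .X) .X :
      Polynomial (Polynomial R)).coeff 6).coeff 0 = -8 * q - 4 := by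
  rw [coeff_six_sigmaForm]
  simp only [Polynomial.coeff_add, Polynomial.coeff_C_mul, Polynomial.coeff_X_pow,
    Polynomial.coeff_X, Polynomial.coeff_C]
  norm_num

theorem coeff_zero_coeff_five_sigmaForm :
    ((sigmaForm (.C (.C q)) (.C (.C s)) (.C (.C c)) (.C (.C r)) (.C (.C n)) (.C .X) .X :
      Polynomial (Polynomial R)).coeff 5).coeff 0 =
    6 - 28 * q - 2 * c + 12 * r - 2 * n + 18 * q ^ 2 := by
  rw [coeff_five_sigmaForm]
  simp only [Polynomial.coeff_add, Polynomial.coeff_C_mul, Polynomial.coeff_X_pow,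
    Polynomial.coeff_X, Polynomial.coeff_C]
  norm_num

theorem coeff_one_coeff_five_sigmaForm :
    ((sigmaForm (.C (.C q)) (.C (.C s)) (.C (.C c)) (.C (.C r)) (.C (.C n)) (.C .X) .X :
      Polynomial (Polynomial R)).coeff 5).coeff 1 = -(32 + 8 * q - 4 * c + 8 * r) := by
  rw [coeff_five_sigmaForm]
  simp only [Polynomial.coeff_add, Polynomial.coeff_C_mul, Polynomial.coeff_X_pow,
    Polynomial.coeff_X, Polynomial.coeff_C]
  norm_num

theorem coeff_two_coeff_five_sigmaForm :
    ((sigmaForm (.C (.C q)) (.C (.C s)) (.C (.C c)) (.C (.C r)) (.C (.C n)) (.C .X) .X :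
      Polynomial (Polynomial R)).coeff 5).coeff 2 = 64 + 36 * q - 2 * c := by
  rw [coeff_five_sigmaForm]
  simp only [Polynomial.coeff_add, Polynomial.coeff_C_mul, Polynomial.coeff_X_pow,
    Polynomial.coeff_X, Polynomial.coeff_C]
  norm_num

end coeff

theorem map_sigmaForm_C_C {R S : Type*} [CommRing R] [CommRing S] (f : R →+* S)
    (q s c r n : R) :
    (sigmaForm (.C (.C q)) (.C (.C s)) (.C (.C c)) (.C (.C r)) (.C (.C n)) (.C .X) .X :
      Polynomial (Polynomial R)).map (Polynomial.mapRingHom f) =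
    sigmaForm (.C (.C (f q))) (.C (.C (f s))) (.C (.C (f c))) (.C (.C (f r))) (.C (.C (f n)))
      (.C .X) .X := by
  simp only [sigmaForm, quarticForm, Polynomial.map_add, Polynomial.map_sub, Polynomial.map_mul,
    Polynomial.map_pow, Polynomial.map_neg, Polynomial.map_one, Polynomial.map_ofNat,
    Polynomial.map_C, Polynomial.map_X, Polynomial.coe_mapRingHom]

variable (K : Type*) [Field K]

/-- The polynomial expressing `σ_{i,j}` in the invariants `q`, `s`, `c`, `r`, `n`. -/
def sigmaPoly (i j : ℕ) : MvPolynomial (Fin 5) K :=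
  (-1) ^ (i + j) * ((sigmaForm (.C (.C (X 0))) (.C (.C (X 1))) (.C (.C (X 2))) (.C (.C (X 3)))
    (.C (.C (X 4))) (.C .X) .X : Polynomial (Polynomial (MvPolynomial (Fin 5) K))).coeff
      (numFix 2 2 - i)).coeff (2 * i - j)

/-- The invariants `q`, `s`, `c`, `r`, `n` of a normal form, as polynomials in its parameters. -/
def invariantPoly : Fin 5 → MvPolynomial (Fin 4) K :=
  let A : MvPolynomial (Fin 4) K := X 0 ^ 2 + 2 * X 0 + 2 * X 1 * X 3 + 1
  let B : MvPolynomial (Fin 4) K := X 3 ^ 2 - 2 * X 3 + 2 * X 0 * X 2 + 4 * X 2 + 1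
  ![X 1 * X 2, X 1 + X 2, A + B - 2 * (X 1 + X 2), X 1 * B + X 2 * A, A * B]

/-- The invariants `q`, `s`, `c`, `r`, `n` of a normal form. -/
def invariants (p : Fin 4 → K) : Fin 5 → K := fun k => eval p (invariantPoly K k)

variable {K}

theorem invariants_eq (p : Fin 4 → K) {A B : K} (hA : A = p 0 ^ 2 + 2 * p 0 + 2 * p 1 * p 3 + 1)
    (hB : B = p 3 ^ 2 - 2 * p 3 + 2 * p 0 * p 2 + 4 * p 2 + 1) :
    invariants K p =
      ![p 1 * p 2, p 1 + p 2, A + B - 2 * (p 1 + p 2), p 1 * B + p 2 * A, A * B] := by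
  funext k
  fin_cases k <;> simp [invariants, invariantPoly, hA, hB]

variable [CharZero K] [IsAlgClosed K]

/-- `Σ_1` specializes from one universal polynomial over `K[q, s, c, r, n]`, and taking coefficients
commutes with specialization. -/
theorem sigma_normalFormOf (p : Fin 4 → K) (i j : ℕ) :
    (normalFormOf p).sigma i j = eval (invariants K p) (sigmaPoly K i j) := by
  have h := sigma1_normalForm (p 0) (p 1) (p 2) (p 3) _ _ rfl rfl
  have hinv := invariants_eq p rfl rfl
  have hmap : (normalFormOf p).Sigma1 =
      (sigmaForm (.C (.C (X 0))) (.C (.C (X 1))) (.C (.C (X 2))) (.C (.C (X 3)))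
        (.C (.C (X 4))) (.C .X) .X : Polynomial (Polynomial (MvPolynomial (Fin 5) K))).map
        (Polynomial.mapRingHom (eval (invariants K p))) := by
    rw [normalFormOf, h, map_sigmaForm_C_C]
    simp [hinv]
  rw [ProjEndo.sigma, hmap, sigmaPoly]
  simp

/-- The system is triangular: the first four coordinates determine `q, c, r, n`, whereas `s` enters
only through `q s`. This is why `q = 0` has to be excluded later. -/
theorem phi_eq (p : Fin 4 → K) {q s c r n : K} (h : invariants K p = ![q, s, c, r, n]) :
    phi K p = ![4 + 8 * q, 64 + 36 * q - 2 * c, 32 + 8 * q - 4 * c + 8 * r,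
      6 - 28 * q - 2 * c + 12 * r - 2 * n + 18 * q ^ 2, 240 - 32 * c + 32 * r - 8 * (q * s)] := by
  have h7 : numFix 2 2 = 7 := rfl
  have h0 := congrFun h 0
  have h1 := congrFun h 1
  have h2 := congrFun h 2
  have h3 := congrFun h 3
  have h4 := congrFun h 4
  simp only [Matrix.cons_val] at h0 h1 h2 h3 h4
  funext k
  fin_cases k
  · simp [phi, sigma_normalFormOf, sigmaPoly, h7, coeff_zero_coeff_six_sigmaForm, h0]
    ring
  · simp [phi, sigma_normalFormOf, sigmaPoly, h7, coeff_two_coeff_five_sigmaForm, h0, h2]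
    ring
  · simp [phi, sigma_normalFormOf, sigmaPoly, h7, coeff_one_coeff_five_sigmaForm, h0, h2, h3]
    ring
  · simp [phi, sigma_normalFormOf, sigmaPoly, h7, coeff_zero_coeff_five_sigmaForm, h0, h2, h3, h4]
    ring
  · simp [phi, sigma_normalFormOf, sigmaPoly, h7, coeff_three_coeff_four_sigmaForm, h0, h1, h2, h3]
    ring

end invariants

/-! ### The fibres of `φ` -/

section fibres

/-- The equation of the hypersurface in the coordinates `q`, `c`, `r`, `n`, `h = q s`. -/
theorem hypersurfaceForm_eq {R : Type*} [CommRing R] (q c r n h : R) :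
    hypersurfaceForm (4 + 8 * q) (64 + 36 * q - 2 * c) (32 + 8 * q - 4 * c + 8 * r)
      (6 - 28 * q - 2 * c + 12 * r - 2 * n + 18 * q ^ 2) (240 - 32 * c + 32 * r - 8 * h) =
    -4096 * (r * h * c * q + 2 * r * h ^ 2 - r ^ 2 * q ^ 2 - n * h ^ 2 + 4 * q ^ 3 * n
      - c ^ 2 * q ^ 3 - 4 * c * q ^ 2 * h - 4 * q * h ^ 2) := by
  unfold hypersurfaceForm
  ring

variable {K : Type*} [Field K]

theorem mem_hypersurfaceX {y : Fin 5 → K} :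
    y ∈ hypersurfaceX K ↔ hypersurfaceForm (y 0) (y 1) (y 2) (y 3) (y 4) = 0 := by
  rw [hypersurfaceX, zeroLocus_span]
  simp [hypersurfaceForm]

/-- Eliminating `b₂` from the definitions of `A` and `B`. -/
theorem exists_quartic (α β A B : K) : ∃ P : Polynomial K, P.natDegree = 4 ∧ ∀ a, P.eval a =
    (A - 1 - a ^ 2 - 2 * a) ^ 2 - 4 * α * (A - 1 - a ^ 2 - 2 * a)
      + 4 * α ^ 2 * (2 * a * β + 4 * β + 1 - B) := by
  refine ⟨.X ^ 4 + .C 4 * .X ^ 3 + .C (4 - 2 * (A - 1) + 4 * α) * .X ^ 2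
    + .C (-4 * (A - 1) + 8 * α + 8 * α ^ 2 * β) * .X
    + .C ((A - 1) ^ 2 - 4 * α * (A - 1) + 4 * α ^ 2 * (4 * β + 1 - B)), ?_, fun a => ?_⟩
  · compute_degree!
  · simp only [Polynomial.eval_add, Polynomial.eval_mul, Polynomial.eval_pow, Polynomial.eval_X,
      Polynomial.eval_C]
    ring

variable [IsAlgClosed K] [CharZero K]

theorem exists_add_eq_mul_eq (s q : K) : ∃ α β : K, α + β = s ∧ α * β = q := by
  obtain ⟨d, hd⟩ := IsAlgClosed.exists_eq_mul_self (s ^ 2 - 4 * q)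
  refine ⟨(s + d) / 2, (s - d) / 2, by ring, ?_⟩
  linear_combination hd / 4

/-- The hypothesis says that `r` is a root of the quadratic with roots `αB + βA` and `αA + βB`;
exchanging `A` and `B` if necessary makes it the first root. -/
theorem exists_pairs {q s m r n : K} (h : r * (s * m - r) = n * s ^ 2 - 4 * q * n + q * m ^ 2) :
    ∃ α β A B : K, α * β = q ∧ α + β = s ∧ A + B = m ∧ A * B = n ∧ α * B + β * A = r := by
  obtain ⟨α, β, rfl, rfl⟩ := exists_add_eq_mul_eq s q
  obtain ⟨A, B, rfl, rfl⟩ := exists_add_eq_mul_eq m n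
  have : (α * B + β * A - r) * (α * A + β * B - r) = 0 := by linear_combination -h
  rcases mul_eq_zero.mp this with h | h
  · exact ⟨α, β, A, B, rfl, rfl, rfl, rfl, sub_eq_zero.mp h⟩
  · exact ⟨α, β, B, A, rfl, rfl, add_comm _ _, mul_comm _ _, sub_eq_zero.mp h⟩

/-- Since `α ≠ 0`, the equation for `A` gives `b₂` in terms of `a₁`; the equation for `B` then
becomes a quartic in `a₁`, which has a root. -/
theorem exists_invariants_eq {q s c r n : K} (hq : q ≠ 0)
    (h : r * (s * (c + 2 * s) - r) = n * s ^ 2 - 4 * q * n + q * (c + 2 * s) ^ 2) :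
    ∃ p, invariants K p = ![q, s, c, r, n] := by
  obtain ⟨α, β, A, B, h1, h2, h3, h4, h5⟩ := exists_pairs h
  have hα : α ≠ 0 := by rintro rfl; simp_all
  obtain ⟨P, hP, hPe⟩ := exists_quartic α β A B
  obtain ⟨a, ha⟩ := IsAlgClosed.exists_root P (by
    intro h0
    rw [Polynomial.natDegree_eq_zero_iff_degree_le_zero.mpr h0.le] at hP
    omega)
  rw [Polynomial.IsRoot, hPe] at ha
  refine ⟨![a, α, β, (A - 1 - a ^ 2 - 2 * a) / (2 * α)], ?_⟩
  rw [invariants_eq (A := A) (B := B)]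
  · simp [h1, h2, h3, h4, h5]
  · simp
    field_simp
    ring
  · simp
    field_simp
    linear_combination -ha

theorem finite_setOf_quadratic (s q : K) : {z : K | z ^ 2 - s * z + q = 0}.Finite := by
  obtain ⟨α, β, rfl, rfl⟩ := exists_add_eq_mul_eq s q
  refine (Set.toFinite {α, β}).subset fun z hz => ?_
  have : (z - α) * (z - β) = 0 := by
    rw [Set.mem_ofPred_eq] at hz
    linear_combination hz
  simpa [sub_eq_zero] using this

/-- `a₂` and `A` are roots of quadratics fixed by the invariants, `a₁` is a root of the resulting
quartic, and `b₁`, `b₂` are then determined. -/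
theorem finite_invariants_fibre {q s c r n : K} (hq : q ≠ 0) :
    {p | invariants K p = ![q, s, c, r, n]}.Finite := by
  choose P hP hPe using exists_quartic (K := K)
  refine ((finite_setOf_quadratic s q).biUnion fun α _ =>
    (finite_setOf_quadratic (c + 2 * s) n).biUnion fun A _ =>
      (((P α (s - α) A (c + 2 * s - A)).rootSet_finite K).image fun a =>
        ![a, α, s - α, (A - 1 - a ^ 2 - 2 * a) / (2 * α)])).subset fun p hp => ?_
  obtain ⟨A, hA⟩ : ∃ A, A = p 0 ^ 2 + 2 * p 0 + 2 * p 1 * p 3 + 1 := ⟨_, rfl⟩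
  obtain ⟨B, hB⟩ : ∃ B, B = p 3 ^ 2 - 2 * p 3 + 2 * p 0 * p 2 + 4 * p 2 + 1 := ⟨_, rfl⟩
  rw [Set.mem_ofPred_eq, invariants_eq p hA hB] at hp
  have h0 := congrFun hp 0
  have h1 := congrFun hp 1
  have h2 := congrFun hp 2
  have h4 := congrFun hp 4
  simp only [Matrix.cons_val] at h0 h1 h2 h4
  have hα : p 1 ≠ 0 := by intro h; simp_all
  have hm : c + 2 * s = A + B := by rw [← h2, ← h1]; ring
  simp only [Set.mem_iUnion]
  refine ⟨p 1, ?_, A, ?_, p 0, ?_, ?_⟩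
  · rw [Set.mem_ofPred_eq, ← h1, ← h0]; ring
  · rw [Set.mem_ofPred_eq, hm, ← h4]; ring
  · rw [Polynomial.mem_rootSet]
    refine ⟨fun h => by simpa [h] using hP (p 1) (s - p 1) A (c + 2 * s - A), ?_⟩
    rw [Polynomial.coe_aeval_eq_eval, hPe, hm, ← h1, hA, hB]
    ring
  · have h3 : p 3 = (A - 1 - p 0 ^ 2 - 2 * p 0) / (2 * p 1) := by
      rw [hA]
      field_simp
      ring
    funext k
    fin_cases k
    · rfl
    · rfl
    · simp [← h1]
    · simp [h3]

theorem phi_mem_hypersurfaceX (p : Fin 4 → K) : phi K p ∈ hypersurfaceX K := by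
  have h := invariants_eq p rfl rfl
  rw [phi_eq p h, mem_hypersurfaceX]
  simp only [Matrix.cons_val]
  rw [hypersurfaceForm_eq]
  ring

/-- The invariants `q`, `s`, `c`, `r`, `n` in terms of the coordinates of `φ`, where `q ≠ 0`. -/
theorem exists_phi_eq_iff {y : Fin 5 → K} (hy : y 0 ≠ 4) : ∃ q s c r n : K, q ≠ 0 ∧
    (∀ p, phi K p = y ↔ invariants K p = ![q, s, c, r, n]) ∧
    y = ![4 + 8 * q, 64 + 36 * q - 2 * c, 32 + 8 * q - 4 * c + 8 * r,
      6 - 28 * q - 2 * c + 12 * r - 2 * n + 18 * q ^ 2, 240 - 32 * c + 32 * r - 8 * (q * s)] := by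
  obtain ⟨q, hq⟩ : ∃ q, q = (y 0 - 4) / 8 := ⟨_, rfl⟩
  obtain ⟨c, hc⟩ : ∃ c, c = (64 + 36 * q - y 1) / 2 := ⟨_, rfl⟩
  obtain ⟨r, hr⟩ : ∃ r, r = (y 2 - 32 - 8 * q + 4 * c) / 8 := ⟨_, rfl⟩
  obtain ⟨n, hn⟩ : ∃ n, n = (6 - 28 * q - 2 * c + 12 * r + 18 * q ^ 2 - y 3) / 2 := ⟨_, rfl⟩
  obtain ⟨s, hs⟩ : ∃ s, s = (240 - 32 * c + 32 * r - y 4) / 8 / q := ⟨_, rfl⟩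
  have hq0 : q ≠ 0 := by
    rw [hq]
    exact div_ne_zero (sub_ne_zero.mpr hy) (by norm_num)
  have hs' : q * s = (240 - 32 * c + 32 * r - y 4) / 8 := by rw [hs]; field_simp
  have hyq : y = ![4 + 8 * q, 64 + 36 * q - 2 * c, 32 + 8 * q - 4 * c + 8 * r,
      6 - 28 * q - 2 * c + 12 * r - 2 * n + 18 * q ^ 2, 240 - 32 * c + 32 * r - 8 * (q * s)] := by
    funext k
    fin_cases k
    · simp; linear_combination -8 * hq
    · simp; linear_combination 2 * hc
    · simp; linear_combination -8 * hr
    · simp; linear_combination 2 * hn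
    · simp; linear_combination 8 * hs'
  refine ⟨q, s, c, r, n, hq0, fun p => ⟨fun h => ?_, fun h => by rw [phi_eq p h, ← hyq]⟩, hyq⟩
  obtain ⟨q', s', c', r', n', hp⟩ : ∃ q' s' c' r' n', invariants K p = ![q', s', c', r', n'] :=
    ⟨_, _, _, _, _, invariants_eq p rfl rfl⟩
  rw [phi_eq p hp, hyq] at h
  have h0 := congrFun h 0
  have h1 := congrFun h 1
  have h2 := congrFun h 2
  have h3 := congrFun h 3
  have h4 := congrFun h 4
  simp only [Matrix.cons_val] at h0 h1 h2 h3 h4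
  obtain rfl : q' = q := by linear_combination h0 / 8
  obtain rfl : c' = c := by linear_combination -h1 / 2
  obtain rfl : r' = r := by linear_combination h2 / 8
  obtain rfl : n' = n := by linear_combination -h3 / 2
  obtain rfl : s' = s := mul_left_cancel₀ hq0 (by linear_combination -h4 / 8)
  exact hp

theorem exists_phi_eq {y : Fin 5 → K} (hy : y 0 ≠ 4) (hX : y ∈ hypersurfaceX K) :
    ∃ p, phi K p = y := by
  obtain ⟨q, s, c, r, n, hq, h, hyq⟩ := exists_phi_eq_iff hy
  simp only [h]
  refine exists_invariants_eq hq ?_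
  rw [mem_hypersurfaceX, hyq] at hX
  simp only [Matrix.cons_val] at hX
  rw [hypersurfaceForm_eq] at hX
  -- On `h = q s` the equation of the hypersurface is the quadratic relation for `r` times `-4096
  -- q²`.
  have h2 : 4096 * q ^ 2 ≠ 0 := mul_ne_zero (by norm_num) (pow_ne_zero 2 hq)
  refine mul_left_cancel₀ h2 ?_
  linear_combination -hX

theorem finite_phi_fibre {y : Fin 5 → K} (hy : y 0 ≠ 4) : (phi K ⁻¹' {y}).Finite := by
  obtain ⟨q, s, c, r, n, hq, h, -⟩ := exists_phi_eq_iff hy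
  refine (finite_invariants_fibre hq).subset fun p hp => (h p).mp hp

end fibres

/-! ### The geometry of the hypersurface -/

section hypersurface

variable {K : Type*} [Field K]

section general

variable {κ : Type*}

theorem zariskiClosure_zeroLocus (I : Ideal (MvPolynomial κ K)) :
    zariskiClosure (zeroLocus K I) = zeroLocus K I :=
  (zeroLocus_vanishingIdeal_galoisConnection (k := K) (K := K)).l_u_l_eq_l I

theorem zariskiClosure_subset_iff {S : Set (κ → K)} {I : Ideal (MvPolynomial κ K)} :
    zariskiClosure S ⊆ zeroLocus K I ↔ S ⊆ zeroLocus K I := by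
  refine ⟨(zeroLocus_vanishingIdeal_le S).trans, fun h => ?_⟩
  rw [← zariskiClosure_zeroLocus]
  exact zeroLocus_anti_mono (vanishingIdeal_anti_mono h)

/-- Removing the zeros of a prime not dividing `F` from the hypersurface `F = 0` leaves a dense
set. -/
theorem vanishingIdeal_zeroLocus_diff [IsAlgClosed K] [Finite κ] {F ℓ : MvPolynomial κ K}
    (hℓ : Prime ℓ) (hF : ¬ ℓ ∣ F) :
    vanishingIdeal K (zeroLocus K (Ideal.span {F}) \ zeroLocus K (Ideal.span {ℓ})) =
      vanishingIdeal K (zeroLocus K (Ideal.span {F})) := by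
  refine le_antisymm (fun g hg => ?_) (vanishingIdeal_anti_mono Set.sdiff_subset)
  have h : ℓ * g ∈ vanishingIdeal K (zeroLocus K (Ideal.span {F})) := by
    intro x hx
    by_cases hxl : x ∈ zeroLocus K (Ideal.span {ℓ})
    · rw [map_mul, hxl ℓ (Ideal.mem_span_singleton_self ℓ), zero_mul]
    · rw [map_mul, hg x ⟨hx, hxl⟩, mul_zero]
  rw [vanishingIdeal_zeroLocus_eq_radical] at h ⊢
  obtain ⟨k, hk⟩ := h
  rw [Ideal.mem_span_singleton] at hk
  obtain ⟨w, hw⟩ := hk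
  rw [mul_pow] at hw
  -- In `ℓ ^ k * g ^ k = F * w` the prime power must divide `w`, so that `F` divides `g ^ k`.
  obtain ⟨w', rfl⟩ := hℓ.pow_dvd_of_dvd_mul_left k hF (Dvd.intro _ hw)
  refine ⟨k, Ideal.mem_span_singleton.mpr ⟨w', ?_⟩⟩
  refine mul_left_cancel₀ (pow_ne_zero k hℓ.ne_zero) ?_
  rw [hw]
  ring

end general

variable (K) in
/-- The equation of the hypersurface as a polynomial. -/
def hypersurfacePoly : MvPolynomial (Fin 5) K :=
  hypersurfaceForm (X 0) (X 1) (X 2) (X 3) (X 4)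

theorem map_hypersurfaceForm {R S : Type*} [CommRing R] [CommRing S] (f : R →+* S)
    (a b c d e : R) :
    f (hypersurfaceForm a b c d e) = hypersurfaceForm (f a) (f b) (f c) (f d) (f e) := by
  simp only [hypersurfaceForm, map_add, map_sub, map_mul, map_pow, map_ofNat]

/-- A translation automorphism carries the prime `X i` to it. -/
theorem prime_X_sub_C {ι : Type*} (i : ι) (a : K) : Prime (X i - C a : MvPolynomial ι K) := by
  classical
  have e1 : (aeval (fun j => X j - C (if j = i then a else 0)) :
      MvPolynomial ι K →ₐ[K] MvPolynomial ι K).comp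
      (aeval fun j => X j + C (if j = i then a else 0)) = AlgHom.id K _ := by
    ext j; simp
  have e2 : (aeval (fun j => X j + C (if j = i then a else 0)) :
      MvPolynomial ι K →ₐ[K] MvPolynomial ι K).comp
      (aeval fun j => X j - C (if j = i then a else 0)) = AlgHom.id K _ := by
    ext j; simp
  have h := (MulEquiv.prime_iff (AlgEquiv.ofAlgHom _ _ e1 e2).toMulEquiv).mpr
    (X_prime (R := K) (i := i))
  simpa using h

theorem mem_zeroLocus_X_sub_C {κ : Type*} {k : κ} {a : K} {y : κ → K} :
    y ∈ zeroLocus K (Ideal.span {X k - C a}) ↔ y k = a := by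
  rw [zeroLocus_span]
  simp [sub_eq_zero]

theorem eval_bind₁ {ι κ : Type*} (p : ι → K) (f : κ → MvPolynomial ι K) (g : MvPolynomial κ K) :
    eval p (bind₁ f g) = eval (fun k => eval p (f k)) g :=
  eval₂Hom_bind₁ _ _ _ _

/-- Restriction of polynomials to the affine subspace `q = h = 0`, which lies in the hypersurface. -/
def planeHom : MvPolynomial (Fin 5) K →ₐ[K] MvPolynomial (Fin 3) K :=
  aeval ![4, 64 - 2 * X 0, 32 - 4 * X 0 + 8 * X 1, 6 - 2 * X 0 + 12 * X 1 - 2 * X 2,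
    240 - 32 * X 0 + 32 * X 1]

theorem planeHom_X (k : Fin 5) : planeHom (X k : MvPolynomial (Fin 5) K) =
    ![4, 64 - 2 * X 0, 32 - 4 * X 0 + 8 * X 1, 6 - 2 * X 0 + 12 * X 1 - 2 * X 2,
      240 - 32 * X 0 + 32 * X 1] k :=
  aeval_X _ k

/-- Some power of `g` is a multiple of `F`, which restricts to zero, and the target is a domain. -/
theorem planeHom_eq_zero [IsAlgClosed K] {g : MvPolynomial (Fin 5) K}
    (hg : g ∈ vanishingIdeal K (hypersurfaceX K)) : planeHom g = 0 := by
  rw [hypersurfaceX, vanishingIdeal_zeroLocus_eq_radical] at hg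
  obtain ⟨k, hk⟩ := hg
  obtain ⟨w, hw⟩ := Ideal.mem_span_singleton.mp hk
  have h0 : planeHom (hypersurfaceForm (X 0) (X 1) (X 2) (X 3) (X 4) : MvPolynomial (Fin 5) K)
      = 0 := by
    refine (map_hypersurfaceForm (planeHom (K := K)).toRingHom _ _ _ _ _).trans ?_
    have := hypersurfaceForm_eq (0 : MvPolynomial (Fin 3) K) (X 0) (X 1) (X 2) 0
    simp only [AlgHom.toRingHom_eq_coe, RingHom.coe_coe, planeHom_X, Matrix.cons_val]
    simpa using this
  have h := congrArg planeHom hw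
  rw [map_mul, h0, zero_mul, map_pow] at h
  exact eq_zero_of_pow_eq_zero h

variable [CharZero K]

theorem planeHom_surjective : Function.Surjective (planeHom (K := K)) := by
  have h (a : K) (ha : a ≠ 0) : (C a⁻¹ * C a : MvPolynomial (Fin 3) K) = 1 := by
    rw [← C_mul, inv_mul_cancel₀ ha, C_1]
  have h2 : (C (2 : K)⁻¹ * 2 : MvPolynomial (Fin 3) K) = 1 := by
    simpa only [map_ofNat] using h 2 two_ne_zero
  have h8 : (C (8 : K)⁻¹ * 8 : MvPolynomial (Fin 3) K) = 1 := by
    simpa only [map_ofNat] using h 8 (by norm_num)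
  rw [← AlgHom.range_eq_top, eq_top_iff, ← adjoin_range_X, Algebra.adjoin_le_iff]
  have e0 : X 0 = planeHom (C (2 : K)⁻¹ * (64 - X 1)) := by
    simp [planeHom_X, map_ofNat]; linear_combination -X 0 * h2
  have e1 : X 1 = planeHom (C (8 : K)⁻¹ * (X 2 - 32 + 4 * (C (2 : K)⁻¹ * (64 - X 1)))) := by
    rw [map_mul, map_add, map_mul, ← e0]
    simp [planeHom_X, map_ofNat]; linear_combination -X 1 * h8
  have e2 : X 2 = planeHom (C (2 : K)⁻¹ * (6 - X 3 - 2 * (C (2 : K)⁻¹ * (64 - X 1))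
      + 12 * (C (8 : K)⁻¹ * (X 2 - 32 + 4 * (C (2 : K)⁻¹ * (64 - X 1)))))) := by
    rw [map_mul, map_add, map_mul _ 12, ← e1, map_sub, map_mul _ 2, ← e0]
    simp [planeHom_X, map_ofNat]; linear_combination -X 2 * h2
  rintro _ ⟨k, rfl⟩
  fin_cases k
  · exact ⟨_, e0.symm⟩
  · exact ⟨_, e1.symm⟩
  · exact ⟨_, e2.symm⟩

theorem not_dvd_hypersurfacePoly : ¬ (X 0 - C 4 : MvPolynomial (Fin 5) K) ∣ hypersurfacePoly K := by
  rintro ⟨w, hw⟩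
  -- This is the point `q = c = r = 0`, `n = h = 1`, where `F = 4096`.
  have h := congrArg (eval ![4, 64, 32, 4, 232]) hw
  rw [hypersurfacePoly, map_hypersurfaceForm] at h
  simp [hypersurfaceForm] at h
  norm_num at h

variable [IsAlgClosed K]

theorem isDenseOpenIn_hypersurfaceX :
    IsDenseOpenIn {y ∈ hypersurfaceX K | y 0 ≠ 4} (hypersurfaceX K) := by
  have h : {y ∈ hypersurfaceX K | y 0 ≠ 4} =
      hypersurfaceX K \ zeroLocus K (Ideal.span {(X 0 - C 4 : MvPolynomial (Fin 5) K)}) := by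
    ext y
    exact and_congr_right fun _ => (not_congr mem_zeroLocus_X_sub_C).symm
  refine ⟨⟨_, h⟩, ?_⟩
  rw [h]
  exact (congrArg (zeroLocus K) (vanishingIdeal_zeroLocus_diff (prime_X_sub_C 0 4)
    not_dvd_hypersurfacePoly)).trans (zariskiClosure_zeroLocus _)

theorem isGenericallyFinite_phi : IsGenericallyFinite (phi K) (hypersurfaceX K) :=
  ⟨_, isDenseOpenIn_hypersurfaceX, fun _ hy => ⟨exists_phi_eq hy.2 hy.1, finite_phi_fibre hy.2⟩⟩

theorem exists_tauNormalForm_eq_eval (ij : (i : Fin (numFix 2 2 + 1)) × Fin (2 * (i : ℕ) + 1)) :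
    ∃ P : MvPolynomial (Fin 4) K, ∀ p, tauNormalForm K p ij = eval p P :=
  ⟨bind₁ (invariantPoly K) (sigmaPoly K ij.1 ij.2), fun p => by
    rw [tauNormalForm, ProjEndo.tau, sigma_normalFormOf, eval_bind₁]
    rfl⟩

theorem isDominantMorphism_phi : IsDominantMorphism (phi K) (hypersurfaceX K) := by
  refine ⟨⟨fun k => bind₁ (invariantPoly K) (![sigmaPoly K 1 2, sigmaPoly K 2 2, sigmaPoly K 2 3,
    sigmaPoly K 2 4, sigmaPoly K 3 3] k), fun p k => ?_⟩, phi_mem_hypersurfaceX, ?_⟩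
  · rw [eval_bind₁]
    fin_cases k <;> exact sigma_normalFormOf p _ _
  · refine Set.Subset.antisymm
      (zariskiClosure_subset_iff.mpr (Set.range_subset_iff.mpr phi_mem_hypersurfaceX)) ?_
    rw [← isDenseOpenIn_hypersurfaceX.2]
    refine zeroLocus_anti_mono (vanishingIdeal_anti_mono fun y hy => exists_phi_eq hy.2 hy.1)

/-! The dimension of the hypersurface. -/

/-- A function annihilated by `X 0 - 4` vanishes on the dense part `X 0 ≠ 4`, hence on all of `X`.
-/
theorem X_sub_C_mem_nonZeroDivisors :
    (Ideal.Quotient.mk (vanishingIdeal K (hypersurfaceX K)) (X 0 - C 4)) ∈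
      nonZeroDivisors (MvPolynomial (Fin 5) K ⧸ vanishingIdeal K (hypersurfaceX K)) := by
  rw [mem_nonZeroDivisors_iff_right]
  intro g hg
  obtain ⟨g, rfl⟩ := Ideal.Quotient.mk_surjective g
  rw [← map_mul, Ideal.Quotient.eq_zero_iff_mem] at hg
  rw [Ideal.Quotient.eq_zero_iff_mem]
  refine (vanishingIdeal_zeroLocus_diff (prime_X_sub_C 0 4) not_dvd_hypersurfacePoly).le ?_
  intro y hy
  have h := hg y hy.1
  rw [map_mul] at h
  refine (mul_eq_zero.mp h).resolve_right fun h0 => hy.2 ?_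
  rw [mem_zeroLocus_X_sub_C]
  simpa [sub_eq_zero] using h0

/-- Killing a nonzerodivisor lowers the Krull dimension by at least one. Applied to `F` in five
variables it gives the upper bound; applied to `X 0 - 4` on `X`, with the quotient map onto three
variables, the lower bound. -/
theorem zariskiDim_hypersurfaceX : zariskiDim (hypersurfaceX K) = 4 := by
  have hF : hypersurfacePoly K ≠ 0 := fun h => not_dvd_hypersurfacePoly (h ▸ dvd_zero _)
  have hle := ringKrullDim_succ_le_of_surjective
    (Ideal.Quotient.mk (vanishingIdeal K (hypersurfaceX K))) Ideal.Quotient.mk_surjective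
    (mem_nonZeroDivisors_of_ne_zero hF) (Ideal.Quotient.eq_zero_iff_mem.mpr
      (le_vanishingIdeal_zeroLocus _ (Ideal.mem_span_singleton_self _)))
  have hge := ringKrullDim_succ_le_of_surjective
    (Ideal.Quotient.lift (vanishingIdeal K (hypersurfaceX K)) (planeHom (K := K)).toRingHom
      fun _ => planeHom_eq_zero)
    (Ideal.Quotient.lift_surjective_of_surjective _ _ planeHom_surjective)
    X_sub_C_mem_nonZeroDivisors (by
      rw [Ideal.Quotient.lift_mk]
      simp [planeHom_X, map_ofNat])
  rw [ringKrullDim_of_isNoetherianRing, ringKrullDim_eq_zero_of_field, zero_add,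
    Nat.card_eq_fintype_card, Fintype.card_fin] at hle hge
  change zariskiDim (hypersurfaceX K) + 1 ≤ _ at hle
  change _ ≤ zariskiDim (hypersurfaceX K) at hge
  have h5 : ((5 : ℕ) : WithBot ℕ∞) = 4 + 1 := by norm_num
  have h4 : ((3 : ℕ) : WithBot ℕ∞) + 1 = 4 := by norm_num
  rw [h5, ENat.WithBot.add_le_add_one_right_iff] at hle
  rw [h4] at hge
  exact le_antisymm hle hge

end hypersurface

/-! ### The complete fixed point multiplier map -/

section tau

variable {K : Type*} [Field K]

/-- The positions of the coordinates of `φ` among the multiplier invariants. -/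
def phiIndex : Fin 5 → (i : Fin (numFix 2 2 + 1)) × Fin (2 * (i : ℕ) + 1) :=
  ![⟨⟨1, by decide⟩, ⟨2, by decide⟩⟩, ⟨⟨2, by decide⟩, ⟨2, by decide⟩⟩,
    ⟨⟨2, by decide⟩, ⟨3, by decide⟩⟩, ⟨⟨2, by decide⟩, ⟨4, by decide⟩⟩,
    ⟨⟨3, by decide⟩, ⟨3, by decide⟩⟩]

theorem tauNormalForm_phiIndex (p : Fin 4 → K) (k : Fin 5) :
    tauNormalForm K p (phiIndex k) = phi K p k := by
  fin_cases k <;> rfl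

theorem tauNormalForm_comp_phiIndex (p : Fin 4 → K) :
    tauNormalForm K p ∘ phiIndex = phi K p :=
  funext (tauNormalForm_phiIndex p)

variable [CharZero K] [IsAlgClosed K]

/-- The factor is `8 q`. Only `s` needs it, through `8 q s = 240 - 32 c + 32 r - σ₃₃`; the other
invariants are already polynomials in the coordinates of `φ`. -/
theorem exists_mul_invariants_eq (k : Fin 5) : ∃ Q : MvPolynomial (Fin 5) K, ∀ p,
    (phi K p 0 - 4) * invariants K p k = eval (phi K p) Q := by
  obtain ⟨q, hq⟩ : ∃ q : MvPolynomial (Fin 5) K, q = C (1 / 8) * (X 0 - C 4) := ⟨_, rfl⟩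
  obtain ⟨c, hc⟩ : ∃ c : MvPolynomial (Fin 5) K, c = C (1 / 2) * (C 64 + C 36 * q - X 1) :=
    ⟨_, rfl⟩
  obtain ⟨r, hr⟩ : ∃ r : MvPolynomial (Fin 5) K,
    r = C (1 / 8) * (X 2 - C 32 - C 8 * q + C 4 * c) := ⟨_, rfl⟩
  obtain ⟨n, hn⟩ : ∃ n : MvPolynomial (Fin 5) K,
    n = C (1 / 2) * (C 6 - C 28 * q - C 2 * c + C 12 * r + C 18 * q ^ 2 - X 3) := ⟨_, rfl⟩
  refine ⟨![C 8 * q * q, C 240 - C 32 * c + C 32 * r - X 4, C 8 * q * c, C 8 * q * r,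
    C 8 * q * n] k, fun p => ?_⟩
  obtain ⟨q', s', c', r', n', hp⟩ : ∃ q' s' c' r' n', invariants K p = ![q', s', c', r', n'] :=
    ⟨_, _, _, _, _, invariants_eq p rfl rfl⟩
  rw [phi_eq p hp, hp]
  obtain ⟨y, hy⟩ : ∃ y, y = ![4 + 8 * q', 64 + 36 * q' - 2 * c', 32 + 8 * q' - 4 * c' + 8 * r',
      6 - 28 * q' - 2 * c' + 12 * r' - 2 * n' + 18 * q' ^ 2,
      240 - 32 * c' + 32 * r' - 8 * (q' * s')] := ⟨_, rfl⟩
  have eq : eval y q = q' := by rw [hq, hy]; simp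
  have ec : eval y c = c' := by
    rw [hc, map_mul, map_sub, map_add, map_mul, eq, hy]; simp
  have er : eval y r = r' := by
    rw [hr, map_mul, map_add, map_sub, map_sub, map_mul, map_mul, eq, ec, hy]; simp; ring
  have en : eval y n = n' := by
    rw [hn]; simp only [map_mul, map_add, map_sub, map_pow, eval_C, eval_X, eq, ec, er]
    rw [hy]; simp
  rw [← hy]
  have e0 : y 0 - 4 = 8 * q' := by rw [hy]; simp
  have e4 : y 4 = 240 - 32 * c' + 32 * r' - 8 * (q' * s') := by rw [hy]; simp
  rw [e0]
  fin_cases k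
  · simp [eq]
  · simp [ec, er, e4]; ring
  · simp [eq, ec]
  · simp [eq, er]
  · simp [eq, en]

theorem exists_pow_mul_eval_invariants_eq (P : MvPolynomial (Fin 5) K) :
    ∃ (d : ℕ) (Q : MvPolynomial (Fin 5) K), ∀ p,
      (phi K p 0 - 4) ^ d * eval (invariants K p) P = eval (phi K p) Q := by
  induction P using MvPolynomial.induction_on with
  | C a => exact ⟨0, C a, fun p => by simp⟩
  | add P₁ P₂ h₁ h₂ =>
    obtain ⟨d₁, Q₁, h₁⟩ := h₁
    obtain ⟨d₂, Q₂, h₂⟩ := h₂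
    refine ⟨d₁ + d₂, (X 0 - C 4) ^ d₂ * Q₁ + (X 0 - C 4) ^ d₁ * Q₂, fun p => ?_⟩
    simp only [map_add, map_mul, map_pow, map_sub, eval_X, eval_C, ← h₁, ← h₂]
    ring
  | mul_X P k h =>
    obtain ⟨d, Q, h⟩ := h
    obtain ⟨Q', h'⟩ := exists_mul_invariants_eq (K := K) k
    refine ⟨d + 1, Q * Q', fun p => ?_⟩
    simp only [map_mul, eval_X, ← h, ← h']
    ring

/-- Pulled back to the parameter space, `σ₁₂ - 4` is a nonzero element of a domain, so a polynomial
vanishing where `σ₁₂ ≠ 4` pulls back to zero. -/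
theorem isDenseOpenIn_closure_range_tau :
    IsDenseOpenIn {y ∈ zariskiClosure (Set.range (tauNormalForm K)) | y (phiIndex 0) ≠ 4}
      (zariskiClosure (Set.range (tauNormalForm K))) := by
  refine ⟨⟨Ideal.span {X (phiIndex 0) - C 4}, ?_⟩, Set.Subset.antisymm
    (zariskiClosure_subset_iff.mpr (Set.sep_subset _ _)) (zeroLocus_anti_mono fun g hg => ?_)⟩
  · ext y
    exact and_congr_right fun _ => (not_congr mem_zeroLocus_X_sub_C).symm
  · choose P hP using exists_tauNormalForm_eq_eval (K := K)
    have he (p : Fin 4 → K) (g : MvPolynomial _ K) :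
        eval p (bind₁ P g) = eval (tauNormalForm K p) g := by
      rw [eval_bind₁]
      exact congrArg (fun x => eval x g) (funext fun ij => (hP ij p).symm)
    have h : bind₁ P (X (phiIndex 0) - C 4) * bind₁ P g = 0 := by
      refine MvPolynomial.funext fun p => ?_
      rw [map_mul, he, he, map_zero, mul_eq_zero, or_iff_not_imp_left]
      intro h4
      refine hg _ ⟨zeroLocus_vanishingIdeal_le _ ⟨p, rfl⟩, fun h => h4 ?_⟩
      simp [h]
    have h0 : bind₁ P (X (phiIndex 0) - C 4) ≠ 0 := by
      intro h
      -- At these parameters `q = 1`, hence `σ₁₂ = 12 ≠ 4`.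
      have := he ![0, 1, 1, 0] (X (phiIndex 0) - C 4)
      rw [h, map_zero, map_sub, eval_X, eval_C, tauNormalForm_phiIndex,
        phi_eq _ (invariants_eq _ rfl rfl)] at this
      simp at this
    have hg0 := (mul_eq_zero.mp h).resolve_left h0
    rintro _ ⟨p, rfl⟩
    change eval (tauNormalForm K p) g = 0
    rw [← he, hg0, map_zero]

theorem comp_phiIndex_mem_hypersurfaceX
    {y : ((i : Fin (numFix 2 2 + 1)) × Fin (2 * (i : ℕ) + 1)) → K}
    (hy : y ∈ zariskiClosure (Set.range (tauNormalForm K))) :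
    y ∘ phiIndex ∈ hypersurfaceX K := by
  have h := hy (rename phiIndex (hypersurfacePoly K)) (by
    rintro _ ⟨p, rfl⟩
    rw [aeval_rename, tauNormalForm_comp_phiIndex]
    exact phi_mem_hypersurfaceX p _ (Ideal.mem_span_singleton_self _))
  rw [aeval_rename, hypersurfacePoly] at h
  have h' := map_hypersurfaceForm (aeval (y ∘ phiIndex)).toRingHom
    (X 0 : MvPolynomial (Fin 5) K) (X 1) (X 2) (X 3) (X 4)
  simp only [AlgHom.toRingHom_eq_coe, RingHom.coe_coe, aeval_X] at h'
  rw [mem_hypersurfaceX]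
  exact h'.symm.trans h

/-- The relations expressing each `(σ₁₂ - 4) ^ d σ_{i,j}` through the coordinates of `φ` extend from
the image to its closure. Where `σ₁₂ ≠ 4` they determine all coordinates from those five. -/
theorem eq_tauNormalForm {y : ((i : Fin (numFix 2 2 + 1)) × Fin (2 * (i : ℕ) + 1)) → K}
    (hy : y ∈ zariskiClosure (Set.range (tauNormalForm K))) (h4 : y (phiIndex 0) ≠ 4)
    {p : Fin 4 → K} (hp : phi K p = y ∘ phiIndex) : tauNormalForm K p = y := by
  funext ij
  obtain ⟨d, Q, h⟩ := exists_pow_mul_eval_invariants_eq (sigmaPoly K ij.1 ij.2)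
  simp only [← sigma_normalFormOf] at h
  have h' := hy ((X (phiIndex 0) - C 4) ^ d * X ij - rename phiIndex Q) (by
    rintro _ ⟨p, rfl⟩
    rw [map_sub, aeval_rename, tauNormalForm_comp_phiIndex]
    change _ - eval (phi K p) Q = 0
    rw [← h p]
    simp only [map_mul, map_pow, map_sub, aeval_X, aeval_C, tauNormalForm_phiIndex]
    exact sub_self _)
  rw [map_sub, aeval_rename, ← hp] at h'
  change _ - eval (phi K p) Q = 0 at h'
  rw [← h p, hp] at h'
  refine mul_left_cancel₀ (pow_ne_zero d (sub_ne_zero.mpr h4)) ?_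
  have h'' := (sub_eq_zero.mp h').symm
  simp only [map_mul, map_pow, map_sub, aeval_X, aeval_C] at h''
  exact h''

theorem isGenericallyFinite_tauNormalForm :
    IsGenericallyFinite (tauNormalForm K) (zariskiClosure (Set.range (tauNormalForm K))) := by
  refine ⟨_, isDenseOpenIn_closure_range_tau, fun y hy => ⟨?_, ?_⟩⟩
  · obtain ⟨p, hp⟩ := exists_phi_eq (y := y ∘ phiIndex) hy.2
      (comp_phiIndex_mem_hypersurfaceX hy.1)
    exact ⟨p, eq_tauNormalForm hy.1 hy.2 hp⟩
  · refine (finite_phi_fibre (y := y ∘ phiIndex) hy.2).subset ?_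
    rintro p rfl
    exact funext fun k => (tauNormalForm_phiIndex p k).symm

end tau

end

end FixedPointMultipliers

theorem mainTheorem9 (K : Type*) [Field K] [IsAlgClosed K] [CharZero K] :
    zariskiDim (hypersurfaceX K) = 4 ∧
    IsDominantMorphism (phi K) (hypersurfaceX K) ∧
    IsGenericallyFinite (phi K) (hypersurfaceX K) ∧
    IsGenericallyFinite (tauNormalForm K) (zariskiClosure (Set.range (tauNormalForm K))) := by
  exact ⟨zariskiDim_hypersurfaceX, isDominantMorphism_phi, isGenericallyFinite_phi,
    isGenericallyFinite_tauNormalForm⟩
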